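/- Let $n,N\in\mathbb N$ with $n\ge 2$, let $C\ge 1$ and $\alpha\in(0,1)$, and let $|\cdot|$ be the Euclidean norm on $\mathbb R^n$, $\mathbb R^N$ and $\mathbb R^{N\times n}$. Let $f:\mathbb R^n\times\mathbb R^{N\times n}\to[0,+\infty)$ be Borel measurable and put $f^\infty(x,\xi):=\limsup_{t\to+\infty} f(x,t\xi)/t$. Suppose that for all $x\in\mathbb R^n$, $\xi\in\mathbb R^{N\times n}$ and $t>0$: - $C^{-1}|\xi|\le f(x,\xi)\le C(|\xi|+1)$; - the maps $f(x,\cdot)$ and $f^\infty(x,\cdot)$ are continuous; - $\left|f^\infty(x,\xi)-\frac{f(x,t\xi)}{t}\right|<\frac{C}{t}\left(1+f(x,t\xi)^{1-\alpha}\right)$. For $x\in\mathbb R^n$ and $r>0$ let $Q_r(x)$ be the open cube with centre $x$, side length $r$ and sides parallel to the coordinate axes. Let $\ell_\xi(y)=\xi y$ and $$m(\xi,x,r):=\inf\left\{\int_{Q_r(x)} f(y,\nabla u(y))\,dy \;:\; u\in W^{1,1}(Q_r(x),\mathbb R^N),\ u=\ell_\xi \text{ on } \partial Q_r(x) \text{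 in the sense of traces}\right\}.$$ Assume that for every $x\in\mathbb R^n$ and $\xi\in\mathbb R^{N\times n}$ the limit $$f_{\rm hom}(\xi):=\lim_{r\to+\infty}\frac{m(\xi,rx,r)}{r^n}$$ exists and is independent of $x$. Then: 1. $f_{\rm hom}$ is quasiconvex, that is, it is Borel measurable and locally bounded, and $|D|\,f_{\rm hom}(\xi)\le\int_D f_{\rm hom}(\xi+\nabla\varphi(x))\,dx$ for every bounded open set $D\subset\mathbb R^n$, every $\xi\in\mathbb R^{N\times n}$ and every Lipschitz map $\varphi:\mathbb R^n\to\mathbb R^N$ that vanishes outside $D$; 2. there is a constant $K$, depending only on $n$, $N$ and $C$, such that $|f_{\rm hom}(\xi_1)-f_{\rm hom}(\xi_2)|\le K|\xi_1-\xi_2|$ for all $\xi_1,\xi_2\in\mathbb R^{N\times n}$; 3. $C^{-1}|\xi|\le f_{\rm hom}(\xi)\le C(|\xi|+1)$ for every $\xi\in\mathbb R^{N\times n}$. -/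

import Mathlib

open MeasureTheory Filter Topology
open scoped ContDiff

noncomputable section

namespace Homog

/-- Euclidean space `ℝᵏ`. -/
abbrev Vec (k : ℕ) : Type := EuclideanSpace ℝ (Fin k)

/-- The space `ℝ^{N×n}` of `N × n` matrices with the Euclidean (Frobenius) norm;
the `(i, j)` entry of `ξ` is `ξ (i, j)`. -/
abbrev Mat (N n : ℕ) : Type := EuclideanSpace ℝ (Fin N × Fin n)

/-- The `j`-th vector of the standard basis of `ℝⁿ`. -/
def basisVec {n : ℕ} (j : Fin n) : Vec n := EuclideanSpace.single j (1 : ℝ)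

/-- The linear map `ℓ_ξ : ℝⁿ → ℝᴺ`, `y ↦ ξ y`, with gradient `ξ`. -/
def linMap {N n : ℕ} (ξ : Mat N n) (y : Vec n) : Vec N :=
  WithLp.toLp 2 fun i => ∑ j, ξ (i, j) * y j

/-- The open cube `Q_ρ(x)` with centre `x`, side length `ρ` and sides parallel to the axes. -/
def cube {n : ℕ} (x : Vec n) (ρ : ℝ) : Set (Vec n) := {y | ∀ i, |y i - x i| < ρ / 2}

/-- The `j`-th component of the outer unit normal to `∂Q_ρ(x)` at a boundary point `y` that lies
in the relative interior of a face (such points are all but a null set of the boundary). -/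
def cubeNormal {n : ℕ} (x : Vec n) (ρ : ℝ) (j : Fin n) (y : Vec n) : ℝ :=
  if y j - x j = ρ / 2 then 1 else if y j - x j = -(ρ / 2) then -1 else 0

/-- `G` is the weak gradient of `u` in the open set `A`:
`∫_A u_i ∂_j φ = - ∫_A G_{ij} φ` for all `φ ∈ C_c^∞(A)` and all `i`, `j`. -/
def IsWeakGradient {N n : ℕ} (A : Set (Vec n)) (u : Vec n → Vec N) (G : Vec n → Mat N n) : Prop :=
  ∀ φ : Vec n → ℝ, ContDiff ℝ ∞ φ → HasCompactSupport φ → tsupport φ ⊆ A →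
    ∀ (i : Fin N) (j : Fin n),
      ∫ y in A, u y i * fderiv ℝ φ y (basisVec j) = -∫ y in A, G y (i, j) * φ y

/-- `u ∈ W^{1,1}(A, ℝᴺ)` with `∇u = G`. -/
structure MemW11 {N n : ℕ} (A : Set (Vec n)) (u : Vec n → Vec N) (G : Vec n → Mat N n) :
    Prop where
  integrable : IntegrableOn u A
  integrable_grad : IntegrableOn G A
  weakGradient : IsWeakGradient A u G

/-- The trace on `∂Q_ρ(x)` of a function `u ∈ W^{1,1}(Q_ρ(x), ℝᴺ)` with `∇u = G` is the
(continuous) function `w`. As usual the trace is the function given by the Gauss-Green formula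
`∫_Q u_i ∂_j φ + ∫_Q (∇u)_{ij} φ = ∫_{∂Q} w_i φ ν_j dℋ^{n-1}` for all `φ ∈ C_c^∞(ℝⁿ)`,
where `ν` is the outer unit normal; `μHE[n - 1]` is the `(n-1)`-dimensional Hausdorff measure,
normalised to be the Lebesgue measure on hyperplanes. -/
def HasTraceOnCube {N n : ℕ} (x : Vec n) (ρ : ℝ) (u : Vec n → Vec N) (G : Vec n → Mat N n)
    (w : Vec n → Vec N) : Prop :=
  ∀ φ : Vec n → ℝ, ContDiff ℝ ∞ φ → HasCompactSupport φ → ∀ (i : Fin N) (j : Fin n),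
    (∫ y in cube x ρ, u y i * fderiv ℝ φ y (basisVec j)) + ∫ y in cube x ρ, G y (i, j) * φ y =
      ∫ y in frontier (cube x ρ), w y i * φ y * cubeNormal x ρ j y ∂μHE[n - 1]

/-- The minimal energy
`inf {∫_Q h(y, ∇u) dy : u ∈ W^{1,1}(Q, ℝᴺ), u = w on ∂Q}` on the cube `Q = Q_ρ(x)`.
For a jointly measurable integrand `h ≥ 0` of linear growth all the integrals are finite. -/
def minEnergy {N n : ℕ} (h : Vec n → Mat N n → ℝ) (w : Vec n → Vec N) (x : Vec n) (ρ : ℝ) : ℝ :=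
  sInf {e | ∃ (u : Vec n → Vec N) (G : Vec n → Mat N n),
    MemW11 (cube x ρ) u G ∧ HasTraceOnCube x ρ u G w ∧ e = ∫ y in cube x ρ, h y (G y)}

/-- The recession function `h^∞(ξ) = limsup_{t → +∞} h(tξ)/t`
(used for `h ≥ 0` of linear growth, so that the limsup is finite). -/
def recession {N n : ℕ} (h : Mat N n → ℝ) (ξ : Mat N n) : ℝ :=
  limsup (fun t : ℝ => h (t • ξ) / t) atTop

/-- The class `𝓕(C, α)` of admissible integrands `f : ℝⁿ × ℝ^{N×n} → [0, +∞)`. -/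
structure Admissible {N n : ℕ} (C α : ℝ) (f : Vec n → Mat N n → ℝ) : Prop where
  nonneg : ∀ x ξ, 0 ≤ f x ξ
  measurable : Measurable fun p : Vec n × Mat N n => f p.1 p.2
  lower : ∀ x ξ, C⁻¹ * ‖ξ‖ ≤ f x ξ
  upper : ∀ x ξ, f x ξ ≤ C * (‖ξ‖ + 1)
  continuous : ∀ x, Continuous fun ξ => f x ξ
  continuous_recession : ∀ x, Continuous fun ξ => recession (f x) ξ
  recession_bound : ∀ x ξ, ∀ t : ℝ, 0 < t →
    |recession (f x) ξ - f x (t • ξ) / t| < C / t * (1 + f x (t • ξ) ^ (1 - α))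

/-- The Jacobian matrix `(∂_j φ_i(x))_{ij}`. -/
def jacobian {N n : ℕ} (φ : Vec n → Vec N) (x : Vec n) : Mat N n :=
  WithLp.toLp 2 fun p => fderiv ℝ φ x (basisVec p.2) p.1

/-- Quasiconvexity in the sense of Morrey: `g` is Borel, locally bounded, and
`|D| g(ξ) ≤ ∫_D g(ξ + ∇φ) dx` for every bounded open set `D`, every `ξ`, and every Lipschitz map
`φ : ℝⁿ → ℝᴺ` that vanishes outside `D` (such a map is differentiable almost everywhere). -/
structure Quasiconvex {N n : ℕ} (g : Mat N n → ℝ) : Prop where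
  measurable : Measurable g
  locallyBounded : ∀ R : ℝ, ∃ M : ℝ, ∀ ξ, ‖ξ‖ ≤ R → |g ξ| ≤ M
  le_integral : ∀ D : Set (Vec n), IsOpen D → Bornology.IsBounded D →
    ∀ (ξ : Mat N n) (φ : Vec n → Vec N), (∃ L, LipschitzWith L φ) → (∀ x, x ∉ D → φ x = 0) →
      volume.real D * g ξ ≤ ∫ x in D, g (ξ + jacobian φ x)

end Homog

end

/-!
The boundary condition `u = ℓ_ξ` is first rewritten: by the Gauss-Green formula for the function
`ℓ_ξ` itself (`gaussGreen_cube`, `hasTraceOnCube_linMap`), a pair `(u, G)` is a competitor for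
`minEnergy` if and only if `(u - ℓ_ξ, G - ξ)` has zero boundary values in the sense of `ZeroTrace`,
an integration by parts without boundary term. Such pairs can be added and extended by zero, and
Lipschitz maps vanishing outside the cube are examples of them.

Everything then rests on one gluing estimate. Let `v` be an `L`-Lipschitz map that vanishes outside
a cube `Q_R` and is affine with slope `A_i` on disjoint subcubes of side `s_i`. Blow `v` up by a
factor `r`, and add almost minimisers for the slopes `ξ + A_i` in the subcubes. The result is a
competitor for `ξ` on the large cube, whose energy outside the subcubes is controlled by the upper
growth bound. As `r → ∞` this gives (`IsHomogenized.mul_le_sum`)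
`R ^ n * g ξ ≤ ∑ s_i ^ n * g (ξ + A_i) + C * (‖ξ‖ + n * L + 1) * (R ^ n - ∑ s_i ^ n)`
for the homogenised integrand `g`; here the freedom in the centre `x` of the limit is used.

* Lipschitz continuity does not go through quasiconvexity. Take for `v` a map of slope `A` on the
  cube of side `1 - δ` that vanishes outside the unit cube. Its Lipschitz constant is of order
  `‖A‖ / δ` and the transition layer has volume of order `δ`, so that `δ → 0` gives
  `g ξ ≤ g (ξ + A) + K * ‖A‖`.
* For quasiconvexity, let `φ` be Lipschitz and zero outside `D`, inside a cube `Q`. By Rademacher's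
  theorem, Lebesgue differentiation and a Vitali covering (`exists_finite_cubes`), `Q` is exhausted
  up to a small set by finitely many disjoint cubes on which `φ` is close to its tangent map at the
  centre and the value of `g (ξ + ∇φ)` at the centre is close to its average. A Lipschitz map equal
  to these tangent maps on slightly smaller cubes is the `v` to use (`exists_lipschitz_affine`).
  This yields the inequality on `Q`, and the part of `Q` outside `D` cancels because `∇φ = 0` almost
  everywhere on `{φ = 0}`.

The growth bounds come from the competitor `ℓ_ξ` and from Jensen's inequality for the norm, since
the gradient of every competitor has mean value `ξ`.
-/

namespace Homog

/-! ### Cubes and the Gauss-Green formula -/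

lemma cube_eq_preimage_ball {n : ℕ} (x : Vec n) {ρ : ℝ} (hρ : 0 < ρ) :
    cube x ρ = WithLp.ofLp ⁻¹' Metric.ball (WithLp.ofLp x) (ρ / 2) := by
  ext y
  simp [cube, dist_pi_lt_iff (half_pos hρ), Real.dist_eq]

lemma isOpen_cube {n : ℕ} (x : Vec n) (ρ : ℝ) : IsOpen (cube x ρ) := by
  simp only [cube, Set.ofPred_forall]
  exact isOpen_iInter_of_finite fun i => isOpen_lt (by fun_prop) continuous_const

lemma measurableSet_cube {n : ℕ} (x : Vec n) (ρ : ℝ) : MeasurableSet (cube x ρ) :=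
  (isOpen_cube x ρ).measurableSet

lemma volume_cube {n : ℕ} (x : Vec n) {ρ : ℝ} (hρ : 0 < ρ) :
    volume (cube x ρ) = ENNReal.ofReal (ρ ^ n) := by
  rw [cube_eq_preimage_ball x hρ, (PiLp.volume_preserving_ofLp (Fin n)).measure_preimage
    Metric.isOpen_ball.measurableSet.nullMeasurableSet, Real.volume_pi_ball _ (half_pos hρ),
    Fintype.card_fin]
  congr 2
  ring

lemma volume_cube_ne_top {n : ℕ} (x : Vec n) {ρ : ℝ} (hρ : 0 < ρ) : volume (cube x ρ) ≠ ⊤ := by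
  simp [volume_cube x hρ]

lemma volumeReal_cube {n : ℕ} (x : Vec n) {ρ : ℝ} (hρ : 0 < ρ) :
    volume.real (cube x ρ) = ρ ^ n := by
  rw [Measure.real, volume_cube x hρ, ENNReal.toReal_ofReal (by positivity)]

lemma cube_ae_eq_preimage_closedBall {n : ℕ} (x : Vec n) {ρ : ℝ} (hρ : 0 < ρ) :
    cube x ρ =ᵐ[volume] WithLp.ofLp ⁻¹' Metric.closedBall (WithLp.ofLp x) (ρ / 2) := by
  rw [cube_eq_preimage_ball x hρ]
  refine (PiLp.volume_preserving_ofLp (Fin n)).quasiMeasurePreserving.preimage_ae_eq ?_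
  refine ae_eq_of_subset_of_measure_ge Metric.ball_subset_closedBall ?_
    Metric.isOpen_ball.measurableSet.nullMeasurableSet measure_closedBall_lt_top.ne
  rw [Real.volume_pi_ball _ (half_pos hρ), Real.volume_pi_closedBall _ (half_pos hρ).le]

lemma mem_frontier_cube {n : ℕ} (x : Vec n) {ρ : ℝ} (hρ : 0 < ρ) (y : Vec n) :
    y ∈ frontier (cube x ρ) ↔ ‖WithLp.ofLp y - WithLp.ofLp x‖ = ρ / 2 := by
  have : cube x ρ = (PiLp.homeomorph 2 fun _ : Fin n => ℝ) ⁻¹'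
      Metric.ball (WithLp.ofLp x) (ρ / 2) := cube_eq_preimage_ball x hρ
  rw [this, ← Homeomorph.preimage_frontier, frontier_ball _ (half_pos hρ).ne',
    Set.mem_preimage, mem_sphere_iff_norm]
  rfl

/-- The isometric embedding of `ℝᵐ` onto the hyperplane `{y | y j = c}` of `ℝᵐ⁺¹`. -/
noncomputable def insertCoord {m : ℕ} (j : Fin (m + 1)) (c : ℝ) (z : Vec m) : Vec (m + 1) :=
  WithLp.toLp 2 (j.insertNth c (WithLp.ofLp z))

lemma isometry_insertCoord {m : ℕ} (j : Fin (m + 1)) (c : ℝ) : Isometry (insertCoord j c) := by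
  refine Isometry.of_dist_eq fun y z => ?_
  simp [insertCoord, EuclideanSpace.dist_eq, Fin.sum_univ_succAbove _ j]

/-- Integration over a face of a cube with respect to the `m`-dimensional Hausdorff measure is
integration over the corresponding box of `ℝᵐ`. -/
lemma setIntegral_insertCoord_image {m : ℕ} (j : Fin (m + 1)) (c : ℝ) (h : Vec (m + 1) → ℝ)
    (s : Set (Fin m → ℝ)) (hs : MeasurableSet s) :
    ∫ y in insertCoord j c '' (WithLp.ofLp ⁻¹' s), h y ∂μHE[m] =
      ∫ z in s, h (WithLp.toLp 2 (j.insertNth c z)) := by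
  have hι := isometry_insertCoord j c
  have he : MeasurableEmbedding (insertCoord j c) := hι.isClosedEmbedding.measurableEmbedding
  have hs' : MeasurableSet ((WithLp.ofLp : Vec m → _) ⁻¹' s) :=
    (PiLp.volume_preserving_ofLp (Fin m)).measurable hs
  have h1 := he.setIntegral_map (μ := (μHE[m] : Measure (Vec m))) h
    (insertCoord j c '' (WithLp.ofLp ⁻¹' s))
  rw [hι.map_euclideanHausdorffMeasure, Measure.restrict_restrict (he.measurableSet_image.2 hs'),
    Set.inter_eq_left.2 (Set.image_subset_range _ _), hι.injective.preimage_image,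
    EuclideanSpace.euclideanHausdorffMeasure_eq_volume] at h1
  rw [h1]
  exact (PiLp.volume_preserving_ofLp (Fin m)).setIntegral_preimage_emb
    (MeasurableEquiv.toLp 2 (Fin m → ℝ)).symm.measurableEmbedding
    (fun z => h (WithLp.toLp 2 (j.insertNth c z))) s

lemma integrableOn_insertCoord_image {m : ℕ} (j : Fin (m + 1)) (c : ℝ) {h : Vec (m + 1) → ℝ}
    (hh : Continuous h) {s : Set (Fin m → ℝ)} (hs : IsCompact s) :
    IntegrableOn h (insertCoord j c '' (WithLp.ofLp ⁻¹' s)) μHE[m] := by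
  have hc : IsCompact ((WithLp.ofLp : Vec m → _) ⁻¹' s) :=
    (PiLp.homeomorph 2 fun _ : Fin m => ℝ).isCompact_preimage.2 hs
  have hι := isometry_insertCoord j c
  refine hh.continuousOn.integrableOn_of_subset_isCompact (hc.image hι.continuous)
    (hc.image hι.continuous).measurableSet le_rfl ?_
  rw [hι.euclideanHausdorffMeasure_image, EuclideanSpace.euclideanHausdorffMeasure_eq_volume]
  exact hc.measure_lt_top.ne

lemma mem_frontier_cube_and_eq_iff {m : ℕ} (x : Vec (m + 1)) {ρ : ℝ} (hρ : 0 < ρ)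
    (j : Fin (m + 1)) {c : ℝ} (hc : |c - x j| = ρ / 2) (y : Vec (m + 1)) :
    (y ∈ frontier (cube x ρ) ∧ y j = c) ↔ y ∈ insertCoord j c '' (WithLp.ofLp ⁻¹'
      Set.Icc (fun i => x (j.succAbove i) - ρ / 2) (fun i => x (j.succAbove i) + ρ / 2)) := by
  rw [mem_frontier_cube x hρ]
  constructor
  · rintro ⟨h1, h2⟩
    refine ⟨WithLp.toLp 2 fun i => y (j.succAbove i), ?_, ?_⟩
    · have h3 : ∀ i, |y i - x i| ≤ ρ / 2 := fun i => by
        simpa [h1] using norm_le_pi_norm (WithLp.ofLp y - WithLp.ofLp x) i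
      refine ⟨fun i => ?_, fun i => ?_⟩ <;> have := abs_le.1 (h3 (j.succAbove i)) <;>
        simp only [] <;> linarith
    · ext i
      refine Fin.succAboveCases j ?_ (fun k => ?_) i
      · simp [insertCoord, h2]
      · simp [insertCoord]
  · rintro ⟨z, hz, rfl⟩
    refine ⟨le_antisymm ((pi_norm_le_iff_of_nonneg (half_pos hρ).le).2 fun i => ?_) ?_,
      by simp [insertCoord]⟩
    · refine Fin.succAboveCases j ?_ (fun k => ?_) i
      · simpa [insertCoord] using hc.le
      · have h1 := hz.1 k
        have h2 := hz.2 k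
        simp only [insertCoord, Pi.sub_apply, Fin.insertNth_apply_succAbove, Real.norm_eq_abs,
          abs_le]
        constructor <;> linarith
    · have := norm_le_pi_norm (WithLp.ofLp (insertCoord j c z) - WithLp.ofLp x) j
      simpa [insertCoord, hc] using this

/-- The Gauss-Green formula on a cube, for a `C¹` function. -/
lemma gaussGreen_cube {m : ℕ} (x : Vec (m + 1)) {ρ : ℝ} (hρ : 0 < ρ) {h : Vec (m + 1) → ℝ}
    (hh : ContDiff ℝ 1 h) (j : Fin (m + 1)) :
    ∫ y in cube x ρ, fderiv ℝ h y (basisVec j) =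
      ∫ y in frontier (cube x ρ), h y * cubeNormal x ρ j y ∂μHE[m] := by
  set a : Fin (m + 1) → ℝ := fun i => x i - ρ / 2 with ha
  set b : Fin (m + 1) → ℝ := fun i => x i + ρ / 2 with hb
  have hdiff := hh.differentiable one_ne_zero
  have hball : Metric.closedBall (WithLp.ofLp x) (ρ / 2) = Set.Icc a b := by
    rw [closedBall_pi _ (half_pos hρ).le]
    simp only [Real.closedBall_eq_Icc]
    exact Set.pi_univ_Icc a b
  set A : (Fin (m + 1) → ℝ) →L[ℝ] Vec (m + 1) :=
    (PiLp.continuousLinearEquiv 2 ℝ fun _ : Fin (m + 1) => ℝ).symm.toContinuousLinearMap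
  have hcont : Continuous fun y => fderiv ℝ h (A y) (basisVec j) :=
    ((hh.continuous_fderiv one_ne_zero).comp A.continuous).clm_apply continuous_const
  have hAj : A (Pi.single j 1) = basisVec j := rfl
  have hsum : ∀ y, ∑ i, (if i = j then (fderiv ℝ h (A y)).comp A else 0 :
          (Fin (m + 1) → ℝ) →L[ℝ] ℝ) (Pi.single i 1) = fderiv ℝ h (A y) (basisVec j) := by
    intro y
    rw [Finset.sum_eq_single j (fun i _ hi => by simp [hi]) (by simp)]
    simp [hAj]
  have key := integral_divergence_of_hasFDerivAt_off_countable' a b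
    (fun i => by simp only [ha, hb]; linarith)
    (fun i y => if i = j then h (A y) else 0)
    (fun i y => if i = j then (fderiv ℝ h (A y)).comp A else 0) ∅ Set.countable_empty
    (fun i => by
      split_ifs
      · exact (hh.continuous.comp A.continuous).continuousOn
      · exact continuousOn_const)
    (fun y _ i => by
      split_ifs
      · exact (hdiff (A y)).hasFDerivAt.comp y A.hasFDerivAt
      · exact hasFDerivAt_const _ _)
    (by
      simp only [hsum]
      exact hcont.continuousOn.integrableOn_Icc)
  have hL : ∫ y in cube x ρ, fderiv ℝ h y (basisVec j) =
      ∫ y in Set.Icc a b, fderiv ℝ h (A y) (basisVec j) := by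
    rw [setIntegral_congr_set (cube_ae_eq_preimage_closedBall x hρ), hball]
    exact (PiLp.volume_preserving_ofLp (Fin (m + 1))).setIntegral_preimage_emb
      (MeasurableEquiv.toLp 2 (Fin (m + 1) → ℝ)).symm.measurableEmbedding
      (fun y => fderiv ℝ h (A y) (basisVec j)) (Set.Icc a b)
  simp only [hsum] at key
  rw [Finset.sum_eq_single j (fun i _ hi => by simp [hi]) (by simp)] at key
  simp only [if_true] at key
  rw [hL, key]
  -- only the two faces orthogonal to the `j`-th axis contribute to the boundary integral
  have hface : ∀ c, |c - x j| = ρ / 2 → frontier (cube x ρ) ∩ {y | y j = c} =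
      insertCoord j c '' (WithLp.ofLp ⁻¹' Set.Icc (a ∘ j.succAbove) (b ∘ j.succAbove)) :=
    fun c hc => Set.ext fun y => mem_frontier_cube_and_eq_iff x hρ j hc y
  have hcp : |b j - x j| = ρ / 2 := by simpa [hb] using (half_pos hρ).le
  have hcm : |a j - x j| = ρ / 2 := by simpa [ha] using (half_pos hρ).le
  have hmeas : ∀ c, MeasurableSet {y : Vec (m + 1) | y j = c} := fun c =>
    (isClosed_eq (by fun_prop) continuous_const).measurableSet
  have hint : ∀ c, |c - x j| = ρ / 2 →
      Integrable ({y : Vec (m + 1) | y j = c}.indicator h)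
        (μHE[m].restrict (frontier (cube x ρ))) := by
    intro c hc
    rw [integrable_indicator_iff (hmeas c), IntegrableOn, Measure.restrict_restrict (hmeas c),
      Set.inter_comm, hface c hc]
    exact integrableOn_insertCoord_image j c hh.continuous isCompact_Icc
  have hval : ∀ c, |c - x j| = ρ / 2 →
      ∫ y in frontier (cube x ρ), {y : Vec (m + 1) | y j = c}.indicator h y ∂μHE[m] =
        ∫ z in Set.Icc (a ∘ j.succAbove) (b ∘ j.succAbove), h (A (j.insertNth c z)) := by
    intro c hc
    rw [setIntegral_indicator (hmeas c), hface c hc,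
      setIntegral_insertCoord_image j c h _ measurableSet_Icc]
    rfl
  rw [← hval _ hcp, ← hval _ hcm, ← integral_sub (hint _ hcp) (hint _ hcm)]
  refine integral_congr_ae (ae_of_all _ fun y => ?_)
  simp only [Set.indicator, Set.mem_ofPred_eq, cubeNormal, ha, hb]
  have e1 : y j = x j + ρ / 2 ↔ y j - x j = ρ / 2 := by constructor <;> intro h <;> linarith
  have e2 : y j = x j - ρ / 2 ↔ y j - x j = -(ρ / 2) := by constructor <;> intro h <;> linarith
  simp only [e1, e2]
  have hne : ρ / 2 ≠ -(ρ / 2) := by linarith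
  by_cases h1 : y j - x j = ρ / 2
  · simp [h1, hne]
  · by_cases h2 : y j - x j = -(ρ / 2)
    · simp [h2, hne.symm]
    · simp [h1, h2]

/-! ### Linear maps and Jacobians -/

/-- `ℓ_ξ` as a continuous linear map. -/
noncomputable def linMapCLM {N n : ℕ} (ξ : Mat N n) : Vec n →L[ℝ] Vec N :=
  LinearMap.toContinuousLinearMap
    { toFun := linMap ξ
      map_add' := fun y z => by
        ext i
        simp [linMap, mul_add, Finset.sum_add_distrib]
      map_smul' := fun c y => by
        ext i
        simp only [linMap, PiLp.smul_apply, smul_eq_mul, RingHom.id_apply, Finset.mul_sum]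
        exact Finset.sum_congr rfl fun j _ => by ring }

@[simp] lemma linMapCLM_apply {N n : ℕ} (ξ : Mat N n) (y : Vec n) : linMapCLM ξ y = linMap ξ y :=
  rfl

lemma linMap_basisVec {N n : ℕ} (ξ : Mat N n) (i : Fin N) (j : Fin n) :
    linMap ξ (basisVec j) i = ξ (i, j) := by
  simp [linMap, basisVec]

lemma continuous_linMap {N n : ℕ} (ξ : Mat N n) : Continuous (linMap ξ) :=
  (linMapCLM ξ).continuous

lemma norm_linMap_le {N n : ℕ} (ξ : Mat N n) (y : Vec n) : ‖linMap ξ y‖ ≤ ‖ξ‖ * ‖y‖ := by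
  refine abs_le_of_sq_le_sq' ?_ (by positivity) |>.2
  rw [mul_pow, EuclideanSpace.norm_sq_eq, EuclideanSpace.norm_sq_eq, EuclideanSpace.norm_sq_eq,
    Fintype.sum_prod_type, Finset.sum_mul]
  refine Finset.sum_le_sum fun i _ => ?_
  simp only [linMap, Real.norm_eq_abs, sq_abs]
  exact Finset.sum_mul_sq_le_sq_mul_sq _ _ _

lemma vec_eq_sum {n : ℕ} (y : Vec n) : y = ∑ j, y j • basisVec j := by
  ext i
  simp [basisVec, Finset.sum_apply, Pi.single_apply]

lemma linMap_jacobian {N n : ℕ} (φ : Vec n → Vec N) (x y : Vec n) :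
    linMap (jacobian φ x) y = fderiv ℝ φ x y := by
  conv_rhs => rw [vec_eq_sum y]
  ext i
  simp [linMap, jacobian, mul_comm]

lemma norm_basisVec {n : ℕ} (j : Fin n) : ‖basisVec j‖ = 1 := by
  simp [basisVec]

lemma norm_jacobian_le {N n : ℕ} {φ : Vec n → Vec N} {L : NNReal} (hφ : LipschitzWith L φ)
    (x : Vec n) : ‖jacobian φ x‖ ≤ n * L := by
  refine abs_le_of_sq_le_sq' ?_ (by positivity) |>.2
  rw [EuclideanSpace.norm_sq_eq, Fintype.sum_prod_type_right]
  calc ∑ j : Fin n, ∑ i : Fin N, ‖jacobian φ x (i, j)‖ ^ 2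
      = ∑ j : Fin n, ‖fderiv ℝ φ x (basisVec j)‖ ^ 2 := by
        refine Finset.sum_congr rfl fun j _ => ?_
        rw [EuclideanSpace.norm_sq_eq]
        rfl
    _ ≤ ∑ j : Fin n, (L : ℝ) ^ 2 := by
        refine Finset.sum_le_sum fun j _ => ?_
        gcongr
        have := (fderiv ℝ φ x).le_of_opNorm_le (norm_fderiv_le_of_lipschitz ℝ hφ) (basisVec j)
        simpa [norm_basisVec] using this
    _ ≤ (n * L : ℝ) ^ 2 := by
        simp only [Finset.sum_const, Finset.card_univ, Fintype.card_fin, nsmul_eq_mul, mul_pow]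
        gcongr
        rcases Nat.eq_zero_or_pos n with h | h
        · simp [h]
        · exact le_self_pow₀ (by exact_mod_cast h) two_ne_zero

lemma measurable_jacobian {N n : ℕ} (φ : Vec n → Vec N) : Measurable (jacobian φ) := by
  refine (PiLp.volume_preserving_toLp (Fin N × Fin n)).measurable.comp ?_
  refine measurable_pi_lambda _ fun p => ?_
  exact (EuclideanSpace.proj p.1 : Vec N →L[ℝ] ℝ).measurable.comp
    (measurable_fderiv_apply_const ℝ φ (basisVec p.2))

/-! ### Competitors with zero boundary values -/

/-- `w` is a Sobolev function on `Q` with gradient `H` and zero boundary values, expressed by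
integration by parts against test functions that need not vanish on the boundary of `Q`. -/
structure ZeroTrace {N n : ℕ} (Q : Set (Vec n)) (w : Vec n → Vec N) (H : Vec n → Mat N n) :
    Prop where
  integrable : IntegrableOn w Q
  integrable_grad : IntegrableOn H Q
  integral_add_eq_zero : ∀ ψ : Vec n → ℝ, ContDiff ℝ ∞ ψ → HasCompactSupport ψ →
    ∀ (i : Fin N) (j : Fin n),
      (∫ y in Q, w y i * fderiv ℝ ψ y (basisVec j)) + ∫ y in Q, H y (i, j) * ψ y = 0

lemma zeroTrace_zero {N n : ℕ} (Q : Set (Vec n)) :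
    ZeroTrace Q (0 : Vec n → Vec N) (0 : Vec n → Mat N n) :=
  ⟨integrableOn_zero, integrableOn_zero, fun ψ _ _ i j => by simp⟩

lemma integrableOn_coord_mul {ι : Type*} [Fintype ι] {n : ℕ} {Q : Set (Vec n)}
    {w : Vec n → EuclideanSpace ℝ ι} (hw : IntegrableOn w Q) (i : ι) {g : Vec n → ℝ}
    (hg : Continuous g) (hgc : HasCompactSupport g) : IntegrableOn (fun y => w y i * g y) Q := by
  obtain ⟨M, hM⟩ := hg.bounded_above_of_compact_support hgc
  exact Integrable.mul_bdd ((EuclideanSpace.proj i : EuclideanSpace ℝ ι →L[ℝ] ℝ).integrable_comp hw)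
    hg.aestronglyMeasurable (ae_of_all _ hM)

lemma continuous_partialDeriv {n : ℕ} {ψ : Vec n → ℝ} (h : ContDiff ℝ ∞ ψ) (v : Vec n) :
    Continuous fun y => fderiv ℝ ψ y v :=
  (h.continuous_fderiv (by simp)).clm_apply continuous_const

lemma hasCompactSupport_partialDeriv {n : ℕ} {ψ : Vec n → ℝ} (h : HasCompactSupport ψ)
    (v : Vec n) : HasCompactSupport fun y => fderiv ℝ ψ y v :=
  h.fderiv_apply ℝ v

/-- The Gauss-Green formula for `ℓ_ξ`: as a Sobolev function on a cube it is its own trace. -/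
lemma hasTraceOnCube_linMap {N n : ℕ} (hn : 1 ≤ n) (x : Vec n) {ρ : ℝ} (hρ : 0 < ρ)
    (ξ : Mat N n) : HasTraceOnCube x ρ (linMap ξ) (fun _ => ξ) (linMap ξ) := by
  intro ψ hψ hc i j
  obtain ⟨m, rfl⟩ : ∃ m, n = m + 1 := ⟨n - 1, by omega⟩
  set A : Vec (m + 1) →L[ℝ] ℝ := (EuclideanSpace.proj i : Vec N →L[ℝ] ℝ).comp (linMapCLM ξ)
  have hA : ∀ y, A y = linMap ξ y i := fun y => rfl
  have hc1 : Continuous fun y => A y * fderiv ℝ ψ y (basisVec j) :=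
    A.continuous.mul (continuous_partialDeriv hψ _)
  have hc2 : Continuous fun y => ξ (i, j) * ψ y := continuous_const.mul hψ.continuous
  have hi1 : IntegrableOn (fun y => A y * fderiv ℝ ψ y (basisVec j)) (cube x ρ) :=
    (hc1.integrable_of_hasCompactSupport (hasCompactSupport_partialDeriv hc _).mul_left).integrableOn
  have hi2 : IntegrableOn (fun y => ξ (i, j) * ψ y) (cube x ρ) :=
    (hc2.integrable_of_hasCompactSupport hc.mul_left).integrableOn
  have hd : ∀ y, fderiv ℝ (fun y => A y * ψ y) y (basisVec j) =
      A y * fderiv ℝ ψ y (basisVec j) + ξ (i, j) * ψ y := by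
    intro y
    rw [fderiv_fun_mul A.differentiableAt (hψ.differentiable (by simp) y)]
    simp [hA, linMap_basisVec, mul_comm]
  have := gaussGreen_cube x hρ (h := fun y => A y * ψ y)
    (A.contDiff.mul (hψ.of_le (by simp))) j
  simp only [hd] at this
  rw [integral_add hi1 hi2] at this
  exact this

lemma isBounded_cube {n : ℕ} (x : Vec n) {ρ : ℝ} (hρ : 0 < ρ) :
    Bornology.IsBounded (cube x ρ) := by
  have hK : IsCompact ((WithLp.ofLp : Vec n → _) ⁻¹' Metric.closedBall (WithLp.ofLp x) (ρ / 2)) :=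
    (PiLp.homeomorph 2 fun _ : Fin n => ℝ).isCompact_preimage.2 (isCompact_closedBall _ _)
  refine hK.isBounded.subset ?_
  rw [cube_eq_preimage_ball x hρ]
  exact Set.preimage_mono Metric.ball_subset_closedBall

lemma integrableOn_linMap {N n : ℕ} (x : Vec n) {ρ : ℝ} (hρ : 0 < ρ) (ξ : Mat N n) :
    IntegrableOn (linMap ξ) (cube x ρ) :=
  ((continuous_linMap ξ).continuousOn.integrableOn_compact
    (isBounded_cube x hρ).isCompact_closure).mono_set subset_closure

/-- Subtracting `ℓ_ξ` turns the boundary condition `u = ℓ_ξ` into zero boundary values. -/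
lemma zeroTrace_of_hasTrace {N n : ℕ} (hn : 1 ≤ n) {x : Vec n} {ρ : ℝ} (hρ : 0 < ρ) {ξ : Mat N n}
    {u : Vec n → Vec N} {G : Vec n → Mat N n} (hu : MemW11 (cube x ρ) u G)
    (ht : HasTraceOnCube x ρ u G (linMap ξ)) :
    ZeroTrace (cube x ρ) (fun y => u y - linMap ξ y) (fun y => G y - ξ) := by
  have hl := integrableOn_linMap x hρ ξ
  have hξ : IntegrableOn (fun _ : Vec n => ξ) (cube x ρ) :=
    integrableOn_const (volume_cube_ne_top x hρ)
  refine ⟨hu.integrable.sub hl, hu.integrable_grad.sub hξ, fun ψ hψ hc i j => ?_⟩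
  have h1 := ht ψ hψ hc i j
  have h2 := hasTraceOnCube_linMap hn x hρ ξ ψ hψ hc i j
  have hd := continuous_partialDeriv hψ (basisVec j)
  have hdc := hasCompactSupport_partialDeriv hc (basisVec j)
  simp only [PiLp.sub_apply, sub_mul]
  rw [integral_sub (integrableOn_coord_mul hu.integrable i hd hdc)
      (integrableOn_coord_mul hl i hd hdc),
    integral_sub (integrableOn_coord_mul hu.integrable_grad (i, j) hψ.continuous hc)
      (integrableOn_coord_mul hξ (i, j) hψ.continuous hc)]
  linarith

lemma ZeroTrace.add_linMap {N n : ℕ} (hn : 1 ≤ n) {x : Vec n} {ρ : ℝ} (hρ : 0 < ρ) (ξ : Mat N n)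
    {w : Vec n → Vec N} {H : Vec n → Mat N n} (h : ZeroTrace (cube x ρ) w H) :
    MemW11 (cube x ρ) (fun y => linMap ξ y + w y) (fun y => ξ + H y) ∧
      HasTraceOnCube x ρ (fun y => linMap ξ y + w y) (fun y => ξ + H y) (linMap ξ) := by
  have hl := integrableOn_linMap x hρ ξ
  have hξ : IntegrableOn (fun _ : Vec n => ξ) (cube x ρ) :=
    integrableOn_const (volume_cube_ne_top x hρ)
  have htr : HasTraceOnCube x ρ (fun y => linMap ξ y + w y) (fun y => ξ + H y) (linMap ξ) := by
    intro ψ hψ hc i j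
    have h1 := h.integral_add_eq_zero ψ hψ hc i j
    have h2 := hasTraceOnCube_linMap hn x hρ ξ ψ hψ hc i j
    have hd := continuous_partialDeriv hψ (basisVec j)
    have hdc := hasCompactSupport_partialDeriv hc (basisVec j)
    simp only [PiLp.add_apply, add_mul]
    rw [integral_add (integrableOn_coord_mul hl i hd hdc)
        (integrableOn_coord_mul h.integrable i hd hdc),
      integral_add (integrableOn_coord_mul hξ (i, j) hψ.continuous hc)
        (integrableOn_coord_mul h.integrable_grad (i, j) hψ.continuous hc)]
    linarith
  refine ⟨⟨hl.add h.integrable, hξ.add h.integrable_grad, fun ψ hψ hc hs i j => ?_⟩, htr⟩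
  have h1 := htr ψ hψ hc i j
  -- test functions supported in the open cube do not see the boundary
  have h3 : ∫ y in frontier (cube x ρ), linMap ξ y i * ψ y * cubeNormal x ρ j y ∂μHE[n - 1] = 0 := by
    refine setIntegral_eq_zero_of_forall_eq_zero fun y hy => ?_
    rw [(isOpen_cube x ρ).frontier_eq] at hy
    have : y ∉ tsupport ψ := fun hy' => hy.2 (hs hy')
    simp [image_eq_zero_of_notMem_tsupport this]
  linarith

/-! ### The minimal energy -/

lemma Admissible.integrableOn {N n : ℕ} {C α : ℝ} {f : Vec n → Mat N n → ℝ}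
    (hf : Admissible C α f) {Q : Set (Vec n)} (hQ : volume Q ≠ ⊤)
    {G : Vec n → Mat N n} (hG : IntegrableOn G Q) : IntegrableOn (fun y => f y (G y)) Q := by
  have hm : AEStronglyMeasurable (fun y => f y (G y)) (volume.restrict Q) :=
    (hf.measurable.comp_aemeasurable
      (aemeasurable_id.prodMk hG.aestronglyMeasurable.aemeasurable)).aestronglyMeasurable
  have hb : IntegrableOn (fun y => C * (‖G y‖ + 1)) Q :=
    (hG.norm.add (integrableOn_const hQ)).const_mul C
  refine hb.mono' hm (ae_of_all _ fun y => ?_)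
  rw [Real.norm_of_nonneg (hf.nonneg _ _)]
  exact hf.upper y (G y)

lemma ZeroTrace.integrableOn_add {N n : ℕ} {Q : Set (Vec n)} (hQ : volume Q ≠ ⊤)
    {w : Vec n → Vec N} {H : Vec n → Mat N n} (h : ZeroTrace Q w H) (ξ : Mat N n) :
    IntegrableOn (fun y => ξ + H y) Q :=
  (integrableOn_const hQ).add h.integrable_grad

lemma Admissible.bddBelow {N n : ℕ} {C α : ℝ} {f : Vec n → Mat N n → ℝ}
    (hf : Admissible C α f) (w : Vec n → Vec N) (x : Vec n) (ρ : ℝ) :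
    BddBelow {e | ∃ (u : Vec n → Vec N) (G : Vec n → Mat N n),
      MemW11 (cube x ρ) u G ∧ HasTraceOnCube x ρ u G w ∧ e = ∫ y in cube x ρ, f y (G y)} := by
  refine ⟨0, ?_⟩
  rintro e ⟨u, G, -, -, rfl⟩
  exact integral_nonneg fun y => hf.nonneg _ _

lemma Admissible.minEnergy_le {N n : ℕ} (hn : 1 ≤ n) {C α : ℝ} {f : Vec n → Mat N n → ℝ}
    (hf : Admissible C α f) {x : Vec n} {ρ : ℝ} (hρ : 0 < ρ) (ξ : Mat N n)
    {w : Vec n → Vec N} {H : Vec n → Mat N n} (h : ZeroTrace (cube x ρ) w H) :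
    minEnergy f (linMap ξ) x ρ ≤ ∫ y in cube x ρ, f y (ξ + H y) :=
  csInf_le (hf.bddBelow _ _ _) ⟨_, _, (h.add_linMap hn hρ ξ).1, (h.add_linMap hn hρ ξ).2, rfl⟩

lemma exists_zeroTrace_integral_lt {N n : ℕ} (hn : 1 ≤ n) (f : Vec n → Mat N n → ℝ)
    (x : Vec n) {ρ : ℝ} (hρ : 0 < ρ) (ξ : Mat N n) {ε : ℝ} (hε : 0 < ε) :
    ∃ (w : Vec n → Vec N) (H : Vec n → Mat N n), ZeroTrace (cube x ρ) w H ∧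
      ∫ y in cube x ρ, f y (ξ + H y) < minEnergy f (linMap ξ) x ρ + ε := by
  have h0 := (zeroTrace_zero (N := N) (cube x ρ)).add_linMap hn hρ ξ
  obtain ⟨e, ⟨u, G, hu, ht, rfl⟩, he⟩ := Real.lt_sInf_add_pos (s := {e | ∃ (u : Vec n → Vec N)
    (G : Vec n → Mat N n), MemW11 (cube x ρ) u G ∧ HasTraceOnCube x ρ u G (linMap ξ) ∧
      e = ∫ y in cube x ρ, f y (G y)}) ⟨_, _, _, h0.1, h0.2, rfl⟩ hε
  exact ⟨_, _, zeroTrace_of_hasTrace hn hρ hu ht, by simpa [minEnergy] using he⟩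

lemma ZeroTrace.integral_grad_eq_zero {N n : ℕ} {x : Vec n} {ρ : ℝ} (hρ : 0 < ρ)
    {w : Vec n → Vec N} {H : Vec n → Mat N n} (h : ZeroTrace (cube x ρ) w H) :
    ∫ y in cube x ρ, H y = 0 := by
  obtain ⟨R, hR⟩ := (isBounded_cube x hρ).subset_ball x
  -- a cutoff function equal to `1` near the cube
  let ψ : ContDiffBump x := ⟨max R 1, max R 1 + 1, by positivity, by linarith⟩
  have hmem : ∀ y ∈ cube x ρ, y ∈ Metric.ball x ψ.rIn := fun y hy =>
    Metric.ball_subset_ball (le_max_left _ _) (hR hy)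
  ext p
  have h1 := h.integral_add_eq_zero ψ ψ.contDiff ψ.hasCompactSupport p.1 p.2
  rw [setIntegral_eq_zero_of_forall_eq_zero (fun y hy => ?_), zero_add] at h1
  · rw [setIntegral_congr_fun (g := fun y => H y p) (measurableSet_cube x ρ) fun y hy => ?_] at h1
    · rw [PiLp.zero_apply, ← h1]
      exact ((EuclideanSpace.proj p : Mat N n →L[ℝ] ℝ).integral_comp_comm h.integrable_grad).symm
    · simp [ψ.one_of_mem_closedBall (Metric.ball_subset_closedBall (hmem y hy))]
  · rw [(ψ.eventuallyEq_one_of_mem_ball (hmem y hy)).fderiv_eq]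
    simp

lemma Admissible.minEnergy_le_mul {N n : ℕ} (hn : 1 ≤ n) {C α : ℝ}
    {f : Vec n → Mat N n → ℝ} (hf : Admissible C α f) (x : Vec n) {ρ : ℝ} (hρ : 0 < ρ)
    (ξ : Mat N n) : minEnergy f (linMap ξ) x ρ ≤ C * (‖ξ‖ + 1) * ρ ^ n := by
  refine (hf.minEnergy_le hn hρ ξ (zeroTrace_zero _)).trans ?_
  have hQ := volume_cube_ne_top x hρ
  calc ∫ y in cube x ρ, f y (ξ + (0 : Vec n → Mat N n) y)
      ≤ ∫ y in cube x ρ, C * (‖ξ‖ + 1) := by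
        refine integral_mono (hf.integrableOn hQ ((zeroTrace_zero _).integrableOn_add hQ ξ))
          (integrableOn_const hQ) fun y => ?_
        simpa using hf.upper y ξ
    _ = C * (‖ξ‖ + 1) * ρ ^ n := by
        rw [setIntegral_const, volumeReal_cube x hρ, smul_eq_mul, mul_comm]

lemma Admissible.mul_le_minEnergy {N n : ℕ} (hn : 1 ≤ n) {C α : ℝ} (hC : 1 ≤ C)
    {f : Vec n → Mat N n → ℝ} (hf : Admissible C α f) (x : Vec n) {ρ : ℝ} (hρ : 0 < ρ)
    (ξ : Mat N n) : C⁻¹ * ‖ξ‖ * ρ ^ n ≤ minEnergy f (linMap ξ) x ρ := by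
  refine le_of_forall_pos_le_add fun ε hε => ?_
  obtain ⟨w, H, h, he⟩ := exists_zeroTrace_integral_lt hn f x hρ ξ hε
  refine le_trans ?_ he.le
  have hQ := volume_cube_ne_top x hρ
  have hi := h.integrableOn_add hQ ξ
  have h1 : ∫ y in cube x ρ, (ξ + H y) = ρ ^ n • ξ := by
    have hξ : IntegrableOn (fun _ : Vec n => ξ) (cube x ρ) := integrableOn_const hQ
    rw [integral_add hξ h.integrable_grad, h.integral_grad_eq_zero hρ,
      setIntegral_const, volumeReal_cube x hρ, add_zero]
  calc C⁻¹ * ‖ξ‖ * ρ ^ n = C⁻¹ * ‖∫ y in cube x ρ, (ξ + H y)‖ := by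
        rw [h1, norm_smul, Real.norm_of_nonneg (by positivity)]
        ring
    _ ≤ C⁻¹ * ∫ y in cube x ρ, ‖ξ + H y‖ := by
        gcongr
        exact norm_integral_le_integral_norm _
    _ = ∫ y in cube x ρ, C⁻¹ * ‖ξ + H y‖ := (integral_const_mul _ _).symm
    _ ≤ _ := integral_mono (hi.norm.const_mul _) (hf.integrableOn hQ hi) fun y => hf.lower _ _

/-! ### Lipschitz maps vanishing outside a set -/

/-- The derivative of a Lipschitz map vanishes almost everywhere on its zero set. -/
lemma ae_fderiv_eq_zero_of_eq_zero {N n : ℕ} (hn : 1 ≤ n) {φ : Vec n → Vec N} {L : NNReal}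
    (hφ : LipschitzWith L φ) : ∀ᵐ x, φ x = 0 → fderiv ℝ φ x = 0 := by
  set s : Set (Vec n) := {x | φ x = 0} ∩ {x | DifferentiableAt ℝ φ x}
  have hs : MeasurableSet s :=
    (isClosed_eq hφ.continuous continuous_const).measurableSet.inter
      (measurableSet_of_differentiableAt ℝ φ)
  have key : ∀ i : Fin N, ∀ᵐ x, x ∈ s → ∀ v, fderiv ℝ φ x v i = 0 := by
    intro i
    set e : Vec n := basisVec ⟨0, hn⟩
    -- turn the `i`-th component of `φ` into a map with values in the line spanned by `e`
    set A : Vec N →L[ℝ] Vec n := (EuclideanSpace.proj i : Vec N →L[ℝ] ℝ).smulRight e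
    have hA : ApproximatesLinearOn (fun x => A (φ x)) (0 : Vec n →L[ℝ] Vec n) s 0 := by
      intro x hx y hy
      have hx' : φ x = 0 := hx.1
      have hy' : φ y = 0 := hy.1
      simp [hx', hy']
    have := hA.norm_fderiv_sub_le volume hs (fun x => A.comp (fderiv ℝ φ x)) fun x hx =>
      (A.hasFDerivAt.comp x hx.2.hasFDerivAt).hasFDerivWithinAt
    rw [ae_restrict_iff' hs] at this
    filter_upwards [this] with x hx hxs v
    have h0 : A.comp (fderiv ℝ φ x) = 0 := by simpa using hx hxs
    have h1 : fderiv ℝ φ x v i • e = 0 := congrArg (fun B : Vec n →L[ℝ] Vec n => B v) h0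
    rcases smul_eq_zero.1 h1 with h | h
    · exact h
    · exact absurd (norm_basisVec (⟨0, hn⟩ : Fin n)) (by simp [show basisVec _ = 0 from h])
  filter_upwards [ae_all_iff.2 key, hφ.ae_differentiableAt] with x hx hd h0
  ext v i
  simpa using hx i ⟨h0, hd⟩ v

lemma ae_jacobian_eq_zero_of_eq_zero {N n : ℕ} (hn : 1 ≤ n) {φ : Vec n → Vec N} {L : NNReal}
    (hφ : LipschitzWith L φ) : ∀ᵐ x, φ x = 0 → jacobian φ x = 0 := by
  filter_upwards [ae_fderiv_eq_zero_of_eq_zero hn hφ] with x hx h0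
  ext p
  simp [jacobian, hx h0]

lemma integrableOn_jacobian {N n : ℕ} {φ : Vec n → Vec N} {L : NNReal} (hφ : LipschitzWith L φ)
    {Q : Set (Vec n)} (hQ : volume Q ≠ ⊤) : IntegrableOn (jacobian φ) Q :=
  (integrableOn_const hQ).mono' (g := fun _ => (n * L : ℝ))
    (measurable_jacobian φ).aestronglyMeasurable (ae_of_all _ fun x => norm_jacobian_le hφ x)

/-- A Lipschitz map that vanishes outside a cube belongs to `W^{1,1}` with zero boundary values. -/
lemma zeroTrace_of_lipschitz {N n : ℕ} (hn : 1 ≤ n) {v : Vec n → Vec N} {L : NNReal}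
    (hv : LipschitzWith L v) {x : Vec n} {ρ : ℝ} (hρ : 0 < ρ) (h0 : ∀ y ∉ cube x ρ, v y = 0) :
    ZeroTrace (cube x ρ) v (jacobian v) := by
  have hQ := volume_cube_ne_top x hρ
  refine ⟨?_, integrableOn_jacobian hv hQ, fun ψ hψ hc i j => ?_⟩
  · refine (hv.continuous.continuousOn.integrableOn_compact
      (isBounded_cube x hρ).isCompact_closure).mono_set subset_closure
  rw [setIntegral_eq_integral_of_forall_compl_eq_zero fun y hy => by simp [h0 y hy],
    setIntegral_eq_integral_of_ae_compl_eq_zero (by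
      filter_upwards [ae_jacobian_eq_zero_of_eq_zero hn hv] with y hy hyQ
      simp [hy (h0 y hyQ)])]
  have hvi : LipschitzWith L fun y => v y i := by
    refine LipschitzWith.of_dist_le_mul fun y z => (le_trans ?_ (hv.dist_le_mul y z))
    rw [dist_eq_norm, dist_eq_norm]
    exact PiLp.norm_apply_le (v y - v z) i
  obtain ⟨D, hD⟩ := (hψ.of_le (by simp : (1 : WithTop ℕ∞) ≤ ∞)).lipschitzWith_of_hasCompactSupport hc one_ne_zero
  have key := hvi.integral_lineDeriv_mul_eq (μ := volume) hD hc (basisVec j)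
  have e1 : ∀ᵐ y, lineDeriv ℝ (fun y => v y i) y (basisVec j) * ψ y = jacobian v y (i, j) * ψ y := by
    filter_upwards [hv.ae_differentiableAt] with y hy
    have := ((EuclideanSpace.proj i : Vec N →L[ℝ] ℝ).hasFDerivAt.comp y hy.hasFDerivAt)
    have h2 : lineDeriv ℝ (fun y => v y i) y (basisVec j) = fderiv ℝ v y (basisVec j) i :=
      (this.hasLineDerivAt (basisVec j)).lineDeriv
    rw [h2]
    rfl
  have e2 : ∀ y, lineDeriv ℝ ψ y (-basisVec j) * v y i = -(v y i * fderiv ℝ ψ y (basisVec j)) := by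
    intro y
    rw [(hψ.differentiable (by simp) y).lineDeriv_eq_fderiv, map_neg]
    ring
  rw [integral_congr_ae e1] at key
  simp only [e2] at key
  rw [key, integral_neg]
  ring

/-! ### Gluing competitors on subcubes -/

lemma ZeroTrace.add {N n : ℕ} {Q : Set (Vec n)} {w w' : Vec n → Vec N} {H H' : Vec n → Mat N n}
    (h : ZeroTrace Q w H) (h' : ZeroTrace Q w' H') : ZeroTrace Q (w + w') (H + H') := by
  refine ⟨h.integrable.add h'.integrable, h.integrable_grad.add h'.integrable_grad,
    fun ψ hψ hc i j => ?_⟩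
  have h1 := h.integral_add_eq_zero ψ hψ hc i j
  have h2 := h'.integral_add_eq_zero ψ hψ hc i j
  have hd := continuous_partialDeriv hψ (basisVec j)
  have hdc := hasCompactSupport_partialDeriv hc (basisVec j)
  simp only [Pi.add_apply, PiLp.add_apply, add_mul]
  rw [integral_add (integrableOn_coord_mul h.integrable i hd hdc)
      (integrableOn_coord_mul h'.integrable i hd hdc),
    integral_add (integrableOn_coord_mul h.integrable_grad (i, j) hψ.continuous hc)
      (integrableOn_coord_mul h'.integrable_grad (i, j) hψ.continuous hc)]
  linarith

lemma ZeroTrace.sum {N n : ℕ} {Q : Set (Vec n)} {ι : Type*} (t : Finset ι)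
    {w : ι → Vec n → Vec N} {H : ι → Vec n → Mat N n} (h : ∀ i ∈ t, ZeroTrace Q (w i) (H i)) :
    ZeroTrace Q (∑ i ∈ t, w i) (∑ i ∈ t, H i) := by
  classical
  induction t using Finset.induction_on with
  | empty => simpa using zeroTrace_zero Q
  | insert a t ha ih =>
    rw [Finset.sum_insert ha, Finset.sum_insert ha]
    exact (h a (Finset.mem_insert_self a t)).add
      (ih fun i hi => h i (Finset.mem_insert_of_mem hi))

/-- Zero boundary values allow extension by zero. -/
lemma ZeroTrace.indicator {N n : ℕ} {P Q : Set (Vec n)} (hP : MeasurableSet P) (hPQ : P ⊆ Q)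
    {w : Vec n → Vec N} {H : Vec n → Mat N n} (h : ZeroTrace P w H) :
    ZeroTrace Q (P.indicator w) (P.indicator H) := by
  refine ⟨((integrable_indicator_iff hP).2 h.integrable).integrableOn,
    ((integrable_indicator_iff hP).2 h.integrable_grad).integrableOn, fun ψ hψ hc i j => ?_⟩
  have e1 : (fun y => P.indicator w y i * fderiv ℝ ψ y (basisVec j)) =
      P.indicator fun y => w y i * fderiv ℝ ψ y (basisVec j) := by
    funext y
    by_cases hy : y ∈ P <;> simp [hy]
  have e2 : (fun y => P.indicator H y (i, j) * ψ y) = P.indicator fun y => H y (i, j) * ψ y := by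
    funext y
    by_cases hy : y ∈ P <;> simp [hy]
  rw [e1, e2, setIntegral_indicator hP, setIntegral_indicator hP, Set.inter_eq_right.2 hPQ]
  exact h.integral_add_eq_zero ψ hψ hc i j

lemma jacobian_eq_of_affine {N n : ℕ} {v : Vec n → Vec N} {A : Mat N n} {P : Set (Vec n)}
    (hP : IsOpen P) (hv : ∀ y ∈ P, ∀ z ∈ P, v y - v z = linMap A (y - z)) {y : Vec n}
    (hy : y ∈ P) : jacobian v y = A := by
  have h1 : v =ᶠ[𝓝 y] fun z => linMapCLM A z + (v y - linMapCLM A y) := by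
    filter_upwards [hP.mem_nhds hy] with z hz
    have := hv z hz y hy
    rw [← linMapCLM_apply, map_sub] at this
    rw [sub_eq_iff_eq_add.1 this]
    abel
  have h2 : HasFDerivAt v (linMapCLM A) y :=
    ((linMapCLM A).hasFDerivAt.add_const _).congr_of_eventuallyEq h1
  ext ⟨i, j⟩
  simp [jacobian, h2.fderiv, linMap_basisVec]

/-- If a Lipschitz perturbation `v` with zero boundary values is affine on disjoint subcubes, then
inserting almost minimisers into the subcubes bounds the minimal energy of the large cube. -/
lemma Admissible.minEnergy_le_sum {N n : ℕ} (hn : 1 ≤ n) {C α : ℝ} (hC : 1 ≤ C)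
    {f : Vec n → Mat N n → ℝ} (hf : Admissible C α f) {x : Vec n} {R : ℝ} (hR : 0 < R)
    (ξ : Mat N n) {v : Vec n → Vec N} {L : NNReal} (hv : LipschitzWith L v)
    (h0 : ∀ y ∉ cube x R, v y = 0) {ι : Type*} (t : Finset ι) (c : ι → Vec n) (s : ι → ℝ)
    (A : ι → Mat N n) (hs : ∀ i ∈ t, 0 < s i) (hsub : ∀ i ∈ t, cube (c i) (s i) ⊆ cube x R)
    (hd : (t : Set ι).PairwiseDisjoint fun i => cube (c i) (s i))
    (hA : ∀ i ∈ t, ∀ y ∈ cube (c i) (s i), ∀ z ∈ cube (c i) (s i),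
      v y - v z = linMap (A i) (y - z)) :
    minEnergy f (linMap ξ) x R ≤ ∑ i ∈ t, minEnergy f (linMap (ξ + A i)) (c i) (s i) +
      C * (‖ξ‖ + n * L + 1) * (R ^ n - ∑ i ∈ t, s i ^ n) := by
  refine le_of_forall_pos_le_add fun ε hε => ?_
  have hδ : 0 < ε / (t.card + 1) := by positivity
  have hex : ∀ i ∈ t, ∃ (w : Vec n → Vec N) (H : Vec n → Mat N n), ZeroTrace (cube (c i) (s i)) w H ∧
      ∫ y in cube (c i) (s i), f y (ξ + A i + H y) <
        minEnergy f (linMap (ξ + A i)) (c i) (s i) + ε / (t.card + 1) := fun i hi =>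
    exists_zeroTrace_integral_lt hn f (c i) (hs i hi) (ξ + A i) hδ
  choose! w H hwH hlt using hex
  have hm : ∀ i, MeasurableSet (cube (c i) (s i)) := fun i => measurableSet_cube _ _
  set U : Set (Vec n) := ⋃ i ∈ t, cube (c i) (s i) with hU
  have hUm : MeasurableSet U := t.measurableSet_biUnion fun i _ => hm i
  have hUQ : U ⊆ cube x R := Set.iUnion₂_subset hsub
  have hQ := volume_cube_ne_top x hR
  set V : Vec n → Mat N n := jacobian v + ∑ i ∈ t, (cube (c i) (s i)).indicator (H i) with hV
  have hz : ZeroTrace (cube x R) (v + ∑ i ∈ t, (cube (c i) (s i)).indicator (w i)) V :=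
    (zeroTrace_of_lipschitz hn hv hR h0).add
      (ZeroTrace.sum t fun i hi => (hwH i hi).indicator (hm i) (hsub i hi))
  have hVin : ∀ i ∈ t, ∀ y ∈ cube (c i) (s i), V y = A i + H i y := by
    intro i hi y hy
    rw [hV, Pi.add_apply, jacobian_eq_of_affine (isOpen_cube _ _) (hA i hi) hy, Finset.sum_apply,
      Finset.sum_eq_single i (fun k hk hki => ?_) (fun h => absurd hi h), Set.indicator_of_mem hy]
    exact Set.indicator_of_notMem
      (fun hyk => Set.disjoint_left.1 (hd hk hi hki) hyk hy) _
  have hVout : ∀ y ∉ U, V y = jacobian v y := by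
    intro y hy
    rw [hV, Pi.add_apply, Finset.sum_apply, Finset.sum_eq_zero (fun i hi => ?_), add_zero]
    exact Set.indicator_of_notMem (fun hyi => hy (Set.mem_biUnion hi hyi)) _
  have hint : IntegrableOn (fun y => f y (ξ + V y)) (cube x R) :=
    hf.integrableOn hQ (hz.integrableOn_add hQ ξ)
  have hvol : volume.real (cube x R \ U) = R ^ n - ∑ i ∈ t, s i ^ n := by
    rw [measureReal_sdiff hUQ hUm hQ, volumeReal_cube x hR, hU,
      measureReal_biUnion_finset hd (fun i _ => hm i)
        fun i hi => volume_cube_ne_top (c i) (hs i hi)]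
    congr 1
    exact Finset.sum_congr rfl fun i hi => volumeReal_cube (c i) (hs i hi)
  have hin : ∫ y in U, f y (ξ + V y) ≤
      ∑ i ∈ t, minEnergy f (linMap (ξ + A i)) (c i) (s i) + ε := by
    rw [hU, integral_biUnion_finset t (fun i _ => hm i) hd
      fun i hi => hint.mono_set (hsub i hi)]
    calc ∑ i ∈ t, ∫ y in cube (c i) (s i), f y (ξ + V y)
        ≤ ∑ i ∈ t, (minEnergy f (linMap (ξ + A i)) (c i) (s i) + ε / (t.card + 1)) := by
          refine Finset.sum_le_sum fun i hi => ?_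
          rw [setIntegral_congr_fun (hm i) (g := fun y => f y (ξ + A i + H i y))
            fun y hy => by simp only [hVin i hi y hy, add_assoc]]
          exact (hlt i hi).le
      _ ≤ _ := by
          rw [Finset.sum_add_distrib, Finset.sum_const, nsmul_eq_mul]
          have : (t.card : ℝ) * (ε / (t.card + 1)) ≤ ε := by
            rw [mul_div_assoc', div_le_iff₀ (by positivity)]
            nlinarith
          linarith
  have hout : ∫ y in cube x R \ U, f y (ξ + V y) ≤
      C * (‖ξ‖ + n * L + 1) * (R ^ n - ∑ i ∈ t, s i ^ n) := by
    have hfin : volume (cube x R \ U) ≠ ⊤ := measure_ne_top_of_subset Set.sdiff_subset hQ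
    calc ∫ y in cube x R \ U, f y (ξ + V y)
        ≤ ∫ y in cube x R \ U, C * (‖ξ‖ + n * L + 1) := by
          refine setIntegral_mono_on (hint.mono_set Set.sdiff_subset) (integrableOn_const hfin)
            ((measurableSet_cube x R).diff hUm) fun y hy => ?_
          rw [hVout y hy.2]
          refine (hf.upper _ _).trans ?_
          gcongr
          exact (norm_add_le _ _).trans (by gcongr; exact norm_jacobian_le hv y)
      _ = _ := by rw [setIntegral_const, hvol, smul_eq_mul, mul_comm]
  calc minEnergy f (linMap ξ) x R ≤ ∫ y in cube x R, f y (ξ + V y) := hf.minEnergy_le hn hR ξ hz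
    _ = (∫ y in U, f y (ξ + V y)) + ∫ y in cube x R \ U, f y (ξ + V y) := by
        rw [← setIntegral_union Set.disjoint_sdiff_right ((measurableSet_cube x R).diff hUm)
          (hint.mono_set hUQ) (hint.mono_set Set.sdiff_subset), Set.union_sdiff_cancel hUQ]
    _ ≤ _ := by linarith

/-! ### Passing to the homogenised integrand -/

/-- `g` is the homogenised integrand of `f`: the limit of the rescaled minimal energies on
`Q_r(rx)` with linear boundary values, for every `x`. -/
def IsHomogenized {N n : ℕ} (f : Vec n → Mat N n → ℝ) (g : Mat N n → ℝ) : Prop :=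
  ∀ (x : Vec n) (ξ : Mat N n),
    Tendsto (fun r : ℝ => minEnergy f (linMap ξ) (r • x) r / r ^ n) atTop (𝓝 (g ξ))

lemma mem_cube_smul {n : ℕ} {r : ℝ} (hr : 0 < r) (c : Vec n) (s : ℝ) (y : Vec n) :
    y ∈ cube (r • c) (r * s) ↔ r⁻¹ • y ∈ cube c s := by
  refine forall_congr' fun i => ?_
  simp only [PiLp.smul_apply, smul_eq_mul]
  have : r⁻¹ * y i - c i = r⁻¹ * (y i - r * c i) := by field_simp
  rw [this, abs_mul, abs_of_pos (inv_pos.2 hr), inv_mul_lt_iff₀ hr, mul_div_assoc]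

lemma IsHomogenized.tendsto_smul {N n : ℕ} {f : Vec n → Mat N n → ℝ} {g : Mat N n → ℝ}
    (h : IsHomogenized f g) (ξ : Mat N n) (c : Vec n) {s : ℝ} (hs : 0 < s) :
    Tendsto (fun r : ℝ => minEnergy f (linMap ξ) (r • c) (r * s) / r ^ n) atTop
      (𝓝 (s ^ n * g ξ)) := by
  have h1 := ((h (s⁻¹ • c) ξ).comp (tendsto_id.atTop_mul_const hs)).const_mul (s ^ n)
  refine h1.congr' ?_
  filter_upwards [eventually_gt_atTop 0] with r hr
  simp only [Function.comp_apply, id, smul_smul, mul_assoc, mul_inv_cancel₀ hs.ne', mul_one,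
    mul_pow]
  field_simp

/-- The homogenised form of the gluing estimate: replacing a linear map by a Lipschitz perturbation
that is affine on most of a cube does not decrease the homogenised energy. -/
lemma IsHomogenized.mul_le_sum {N n : ℕ} (hn : 1 ≤ n) {C α : ℝ} (hC : 1 ≤ C)
    {f : Vec n → Mat N n → ℝ} (hf : Admissible C α f) {g : Mat N n → ℝ} (hg : IsHomogenized f g)
    {R : ℝ} (hR : 0 < R) (ξ : Mat N n) {v : Vec n → Vec N} {L : NNReal} (hv : LipschitzWith L v)
    (h0 : ∀ y ∉ cube (0 : Vec n) R, v y = 0) {ι : Type*} (t : Finset ι) (c : ι → Vec n) (s : ι → ℝ)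
    (A : ι → Mat N n) (hs : ∀ i ∈ t, 0 < s i)
    (hsub : ∀ i ∈ t, cube (c i) (s i) ⊆ cube (0 : Vec n) R)
    (hd : (t : Set ι).PairwiseDisjoint fun i => cube (c i) (s i))
    (hA : ∀ i ∈ t, ∀ y ∈ cube (c i) (s i), ∀ z ∈ cube (c i) (s i),
      v y - v z = linMap (A i) (y - z)) :
    R ^ n * g ξ ≤ ∑ i ∈ t, s i ^ n * g (ξ + A i) +
      C * (‖ξ‖ + n * L + 1) * (R ^ n - ∑ i ∈ t, s i ^ n) := by
  refine le_of_tendsto_of_tendsto (hg.tendsto_smul ξ 0 hR)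
    ((tendsto_finsetSum t fun i hi => hg.tendsto_smul (ξ + A i) (c i) (hs i hi)).add_const _) ?_
  filter_upwards [eventually_gt_atTop 0] with r hr
  have hlip : LipschitzWith L fun y => r • v (r⁻¹ • y) := by
    refine LipschitzWith.of_dist_le_mul fun y z => ?_
    have := hv.dist_le_mul (r⁻¹ • y) (r⁻¹ • z)
    rw [dist_smul₀, Real.norm_of_nonneg (inv_pos.2 hr).le] at this
    rw [dist_smul₀, Real.norm_of_nonneg hr.le]
    calc r * dist (v (r⁻¹ • y)) (v (r⁻¹ • z)) ≤ r * (L * (r⁻¹ * dist y z)) := by gcongr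
      _ = L * dist y z := by field_simp
  have key := hf.minEnergy_le_sum hn hC (x := r • 0) (mul_pos hr hR) ξ hlip
    (fun y hy => by
      rw [mem_cube_smul hr] at hy
      simp [h0 _ hy]) t (fun i => r • c i) (fun i => r * s i) A
    (fun i hi => mul_pos hr (hs i hi))
    (fun i hi y hy => by
      rw [mem_cube_smul hr] at hy ⊢
      exact hsub i hi hy)
    (fun i hi k hk hik => Set.disjoint_left.2 fun y hy hy' => by
      rw [mem_cube_smul hr] at hy hy'
      exact Set.disjoint_left.1 (hd hi hk hik) hy hy')
    (fun i hi y hy z hz => by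
      rw [mem_cube_smul hr] at hy hz
      rw [← smul_sub, hA i hi _ hy _ hz, ← smul_sub, ← linMapCLM_apply, map_smul, smul_smul,
        mul_inv_cancel₀ hr.ne', one_smul, linMapCLM_apply])
  rw [div_le_iff₀ (by positivity), add_mul, Finset.sum_mul]
  refine key.trans_eq ?_
  congr 1
  · exact Finset.sum_congr rfl fun i _ => (div_mul_cancel₀ _ (by positivity)).symm
  · simp only [mul_pow, ← Finset.mul_sum]
    ring

/-! ### Growth bounds for the homogenised integrand -/

lemma IsHomogenized.le_mul {N n : ℕ} (hn : 1 ≤ n) {C α : ℝ} {f : Vec n → Mat N n → ℝ}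
    (hf : Admissible C α f) {g : Mat N n → ℝ} (hg : IsHomogenized f g) (ξ : Mat N n) :
    g ξ ≤ C * (‖ξ‖ + 1) := by
  refine le_of_tendsto (hg 0 ξ) ?_
  filter_upwards [eventually_gt_atTop 0] with r hr
  rw [div_le_iff₀ (by positivity)]
  exact hf.minEnergy_le_mul hn _ hr ξ

lemma IsHomogenized.mul_le {N n : ℕ} (hn : 1 ≤ n) {C α : ℝ} (hC : 1 ≤ C)
    {f : Vec n → Mat N n → ℝ} (hf : Admissible C α f) {g : Mat N n → ℝ} (hg : IsHomogenized f g)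
    (ξ : Mat N n) : C⁻¹ * ‖ξ‖ ≤ g ξ := by
  refine ge_of_tendsto (hg 0 ξ) ?_
  filter_upwards [eventually_gt_atTop 0] with r hr
  rw [le_div_iff₀ (by positivity)]
  exact hf.mul_le_minEnergy hn hC _ hr ξ

lemma IsHomogenized.nonneg {N n : ℕ} (hn : 1 ≤ n) {C α : ℝ} (hC : 1 ≤ C)
    {f : Vec n → Mat N n → ℝ} (hf : Admissible C α f) {g : Mat N n → ℝ} (hg : IsHomogenized f g)
    (ξ : Mat N n) : 0 ≤ g ξ :=
  le_trans (by positivity) (hg.mul_le hn hC hf ξ)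

/-! ### Replacing a Lipschitz map by affine maps on subcubes -/

/-- A point of the concentric cube shrunk by the factor `1 - δ` has distance at least `δ s / 2`
from every point outside the cube. -/
lemma mul_le_two_mul_dist {n : ℕ} {c y z : Vec n} {s δ : ℝ} (hy : y ∈ cube c ((1 - δ) * s))
    (hz : z ∉ cube c s) : δ * s ≤ 2 * dist y z := by
  simp only [cube, Set.mem_ofPred_eq, not_forall, not_lt] at hz
  obtain ⟨i, hi⟩ := hz
  have h1 := hy i
  have h2 : |y i - z i| ≤ dist y z := by
    rw [dist_eq_norm]
    exact PiLp.norm_apply_le (y - z) i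
  have h3 : |z i - c i| ≤ |y i - z i| + |y i - c i| := by
    rw [abs_sub_comm (y i) (z i)]
    exact abs_sub_le _ _ _
  linarith

lemma cube_subset_cube {n : ℕ} (c : Vec n) {s s' : ℝ} (h : s ≤ s') : cube c s ⊆ cube c s' :=
  fun _ hy i => (hy i).trans_le (by linarith)

/-- Let `φ` be Lipschitz and uniformly close to affine maps on the concentric subcubes, shrunk by
`1 - δ`, of disjoint cubes in `Q`. Prescribing the affine maps on the subcubes and `φ` outside `Q`
gives a Lipschitz map, because of the gaps between the subcubes; any Lipschitz extension of it
serves as `v`. This replaces an explicit interpolation with cutoff functions. -/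
lemma exists_lipschitz_affine {N n : ℕ} {φ : Vec n → Vec N} {L : NNReal} (hφ : LipschitzWith L φ)
    {Q : Set (Vec n)} {ι : Type*} (t : Finset ι) (c : ι → Vec n) (s : ι → ℝ) (b : ι → Vec N)
    (A : ι → Mat N n) {Λ ε δ : NNReal} (hδ : 0 < δ) (hs : ∀ i ∈ t, 0 < s i)
    (hsub : ∀ i ∈ t, cube (c i) (s i) ⊆ Q)
    (hd : (t : Set ι).PairwiseDisjoint fun i => cube (c i) (s i))
    (hΛ : ∀ i ∈ t, ‖A i‖ ≤ Λ)
    (hclose : ∀ i ∈ t, ∀ y ∈ cube (c i) ((1 - δ) * s i),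
      ‖φ y - (b i + linMap (A i) y)‖ ≤ ε * s i) :
    ∃ v : Vec n → Vec N,
      LipschitzWith (lipschitzExtensionConstant (Vec N) * (L + Λ + 4 * ε / δ)) v ∧
      (∀ y ∉ Q, v y = φ y) ∧
      ∀ i ∈ t, ∀ y ∈ cube (c i) ((1 - δ) * s i), v y = b i + linMap (A i) y := by
  classical
  have hδ' : (0 : ℝ) < δ := hδ
  have hsm : ∀ i ∈ t, cube (c i) ((1 - δ) * s i) ⊆ cube (c i) (s i) := fun i hi =>
    cube_subset_cube _ (by nlinarith [hs i hi])
  set P : Set (Vec n) := ⋃ i ∈ t, cube (c i) ((1 - δ) * s i) with hP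
  -- the prescribed map and the set on which it is prescribed
  set w : Vec n → Vec N := fun y =>
    if h : ∃ i ∈ t, y ∈ cube (c i) ((1 - δ) * s i) then b h.choose + linMap (A h.choose) y
    else φ y with hw
  have hw1 : ∀ i ∈ t, ∀ y ∈ cube (c i) ((1 - δ) * s i), w y = b i + linMap (A i) y := by
    intro i hi y hy
    have h : ∃ i ∈ t, y ∈ cube (c i) ((1 - δ) * s i) := ⟨i, hi, hy⟩
    have heq : h.choose = i := by
      by_contra hne
      exact Set.disjoint_left.1 (hd h.choose_spec.1 hi hne)
        (hsm _ h.choose_spec.1 h.choose_spec.2) (hsm i hi hy)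
    simp only [hw, dif_pos h]
    rw [heq]
  have hw2 : ∀ y ∉ Q, w y = φ y := by
    intro y hy
    have h : ¬ ∃ i ∈ t, y ∈ cube (c i) ((1 - δ) * s i) := by
      rintro ⟨i, hi, hyi⟩
      exact hy (hsub i hi (hsm i hi hyi))
    simp only [hw, dif_neg h]
  have hφd : ∀ y z, ‖φ y - φ z‖ ≤ L * dist y z := fun y z => by
    rw [← dist_eq_norm]
    exact hφ.dist_le_mul y z
  -- the gap between subcubes controls the error `ε s` by the distance
  have hgap : ∀ i ∈ t, ∀ y ∈ cube (c i) ((1 - δ) * s i), ∀ z ∉ cube (c i) (s i),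
      ε * s i ≤ 2 * ε / δ * dist y z := by
    intro i hi y hy z hz
    have h1 := mul_le_two_mul_dist hy hz
    calc (ε : ℝ) * s i = ε / δ * (δ * s i) := by field_simp
      _ ≤ ε / δ * (2 * dist y z) := by gcongr
      _ = 2 * ε / δ * dist y z := by ring
  have hout : ∀ i ∈ t, ∀ y ∈ cube (c i) ((1 - δ) * s i), ∀ z ∉ Q,
      ‖w y - w z‖ ≤ (L + Λ + 4 * ε / δ) * dist y z := by
    intro i hi y hy z hz
    have h1 := hgap i hi y hy z fun hz' => hz (hsub i hi hz')
    have h2 := hclose i hi y hy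
    rw [hw1 i hi y hy, hw2 z hz]
    have h3 : b i + linMap (A i) y - φ z = (φ y - φ z) - (φ y - (b i + linMap (A i) y)) := by abel
    rw [h3]
    have h4 : (0 : ℝ) ≤ Λ * dist y z := by positivity
    have h5 : (0 : ℝ) ≤ 2 * ε / δ * dist y z := by positivity
    have h6 : (4 * ε / δ : ℝ) * dist y z = 2 * (2 * ε / δ * dist y z) := by ring
    linarith [norm_sub_le (φ y - φ z) (φ y - (b i + linMap (A i) y)), hφd y z]
  have hlip : LipschitzOnWith (L + Λ + 4 * ε / δ) w (P ∪ Qᶜ) := by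
    refine LipschitzOnWith.of_dist_le_mul fun y hy z hz => ?_
    push_cast
    rw [dist_eq_norm]
    have h4 : (0 : ℝ) ≤ Λ * dist y z := by positivity
    have h0 : (0 : ℝ) ≤ L * dist y z := by positivity
    have h5 : (0 : ℝ) ≤ 2 * ε / δ * dist y z := by positivity
    have h6 : (4 * ε / δ : ℝ) * dist y z = 2 * (2 * ε / δ * dist y z) := by ring
    rcases hy with hy | hy <;> rcases hz with hz | hz
    · obtain ⟨i, hi, hyi⟩ := Set.mem_iUnion₂.1 hy
      obtain ⟨k, hk, hzk⟩ := Set.mem_iUnion₂.1 hz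
      rw [hw1 i hi y hyi, hw1 k hk z hzk]
      by_cases hik : i = k
      · subst hik
        have h1 : b i + linMap (A i) y - (b i + linMap (A i) z) = linMap (A i) (y - z) := by
          rw [← linMapCLM_apply, ← linMapCLM_apply, ← linMapCLM_apply, map_sub]
          abel
        rw [h1]
        have h2 := norm_linMap_le (A i) (y - z)
        have h3 : ‖A i‖ * ‖y - z‖ ≤ Λ * dist y z := by
          rw [dist_eq_norm]
          gcongr
          exact hΛ i hi
        linarith
      · have g1 := hgap i hi y hyi z fun hz' =>
          Set.disjoint_left.1 (hd hi hk hik) hz' (hsm k hk hzk)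
        have g2 := hgap k hk z hzk y fun hy' =>
          Set.disjoint_left.1 (hd hi hk hik) (hsm i hi hyi) hy'
        rw [dist_comm] at g2
        have c1 := hclose i hi y hyi
        have c2 := hclose k hk z hzk
        have h1 : b i + linMap (A i) y - (b k + linMap (A k) z) =
            (φ y - φ z) - (φ y - (b i + linMap (A i) y)) + (φ z - (b k + linMap (A k) z)) := by
          abel
        rw [h1]
        linarith [norm_sub_le (φ y - φ z) (φ y - (b i + linMap (A i) y)), hφd y z,
          norm_add_le (φ y - φ z - (φ y - (b i + linMap (A i) y)))
            (φ z - (b k + linMap (A k) z))]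
    · obtain ⟨i, hi, hyi⟩ := Set.mem_iUnion₂.1 hy
      exact hout i hi y hyi z hz
    · obtain ⟨k, hk, hzk⟩ := Set.mem_iUnion₂.1 hz
      rw [norm_sub_rev, dist_comm]
      exact hout k hk z hzk y hy
    · rw [hw2 y hy, hw2 z hz]
      linarith [hφd y z]
  obtain ⟨v, hv, hwv⟩ := hlip.extend_finite_dimension
  refine ⟨v, hv, fun y hy => ?_, fun i hi y hy => ?_⟩
  · rw [← hwv (Or.inr hy), hw2 y hy]
  · rw [← hwv (Or.inl (Set.mem_biUnion hi hy)), hw1 i hi y hy]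

/-! ### Lipschitz continuity -/

lemma one_sub_pow_le {δ : ℝ} (h1 : δ ≤ 1) (n : ℕ) : 1 - (1 - δ) ^ n ≤ n * δ := by
  have := one_add_mul_le_pow (a := -δ) (by linarith) n
  rw [← sub_eq_add_neg] at this
  linarith

lemma norm_le_of_mem_cube_zero {n : ℕ} {y : Vec n} {ρ : ℝ} (hy : y ∈ cube (0 : Vec n) ρ)
    (hρ : ρ ≤ 1) : ‖y‖ ≤ n := by
  refine abs_le_of_sq_le_sq' ?_ (by positivity) |>.2
  rw [EuclideanSpace.norm_sq_eq]
  calc ∑ i, ‖y i‖ ^ 2 ≤ ∑ _i : Fin n, (1 : ℝ) := by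
        refine Finset.sum_le_sum fun i _ => ?_
        have : |y i| < ρ / 2 := by simpa using hy i
        exact pow_le_one₀ (norm_nonneg _) (by rw [Real.norm_eq_abs]; linarith)
    _ ≤ (n : ℝ) ^ 2 := by
        simp only [Finset.sum_const, Finset.card_univ, Fintype.card_fin, nsmul_eq_mul, mul_one]
        exact_mod_cast Nat.le_self_pow two_ne_zero n

/-- The bound is obtained from a thin boundary layer of width `δ` in which a linear map of slope
`A` is cut off: the gradient there is of order `‖A‖ / δ`, and the volume of order `δ`. Linear growth
makes the cost of the layer bounded by `‖A‖` in the limit `δ → 0`. -/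
lemma IsHomogenized.le_add_mul_norm {N n : ℕ} (hn : 1 ≤ n) {C α : ℝ} (hC : 1 ≤ C)
    {f : Vec n → Mat N n → ℝ} (hf : Admissible C α f) {g : Mat N n → ℝ} (hg : IsHomogenized f g)
    (ξ A : Mat N n) :
    g ξ ≤ g (ξ + A) + C * 4 * n ^ 3 * lipschitzExtensionConstant (Vec N) * ‖A‖ := by
  set κ := lipschitzExtensionConstant (Vec N)
  set B : ℝ := C * (‖ξ‖ + n * (κ * ‖A‖) + 1) * n with hB
  have key : ∀ δ : NNReal, 0 < δ → δ < 1 →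
      g ξ ≤ g (ξ + A) + C * 4 * n ^ 3 * κ * ‖A‖ + B * δ := by
    intro δ hδ hδ1
    have hδ' : (0 : ℝ) < δ := hδ
    have hδ1' : (δ : ℝ) < 1 := hδ1
    obtain ⟨v, hv, hv0, hva⟩ := exists_lipschitz_affine (φ := fun _ : Vec n => (0 : Vec N))
      (L := 0) (LipschitzWith.const 0) (Q := cube (0 : Vec n) 1) (Finset.univ : Finset Unit)
      (fun _ => 0) (fun _ => 1) (fun _ => 0) (fun _ => A) (Λ := ‖A‖₊) (ε := ‖A‖₊ * n) hδ
      (fun _ _ => one_pos) (fun _ _ => subset_rfl)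
      (fun i _ k _ hik => absurd (Subsingleton.elim i k) hik) (fun _ _ => le_rfl)
      (fun _ _ y hy => by
        simp only [zero_add, zero_sub, norm_neg, mul_one, NNReal.coe_mul, coe_nnnorm,
          NNReal.coe_natCast]
        refine (norm_linMap_le A y).trans ?_
        gcongr
        exact norm_le_of_mem_cube_zero hy (by linarith))
    have h1 := hg.mul_le_sum hn hC hf one_pos ξ hv (fun y hy => hv0 y hy)
      (Finset.univ : Finset Unit) (fun _ => 0) (fun _ => 1 - δ) (fun _ => A)
      (fun _ _ => by linarith) (fun _ _ => cube_subset_cube _ (by linarith))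
      (fun i _ k _ hik => absurd (Subsingleton.elim i k) hik)
      (fun i hi y hy z hz => by
        rw [hva i hi y (by simpa using hy), hva i hi z (by simpa using hz),
          ← linMapCLM_apply, ← linMapCLM_apply, ← linMapCLM_apply, map_sub]
        abel)
    simp only [Finset.univ_unique, Finset.sum_singleton, one_pow, one_mul] at h1
    push_cast at h1
    have h2 := one_sub_pow_le hδ1'.le n
    have h3 : (1 - (δ : ℝ)) ^ n * g (ξ + A) ≤ g (ξ + A) :=
      mul_le_of_le_one_left (hg.nonneg hn hC hf _) (pow_le_one₀ (by linarith) (by linarith))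
    have h4 : C * (‖ξ‖ + n * (κ * (0 + ‖A‖ + 4 * (‖A‖ * n) / δ)) + 1) * (1 - (1 - (δ : ℝ)) ^ n) ≤
        C * (‖ξ‖ + n * (κ * (0 + ‖A‖ + 4 * (‖A‖ * n) / δ)) + 1) * (n * δ) := by
      gcongr
    have h5 : C * (‖ξ‖ + n * (κ * (0 + ‖A‖ + 4 * (‖A‖ * n) / δ)) + 1) * (n * δ) =
        C * 4 * n ^ 3 * κ * ‖A‖ + B * δ := by
      rw [hB]
      field_simp
      ring
    have h6 := (h1.trans (add_le_add h3 h4)).trans_eq (by rw [h5])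
    linarith
  have hlim : Tendsto (fun δ : ℝ => g (ξ + A) + C * 4 * n ^ 3 * κ * ‖A‖ + B * δ) (𝓝[>] 0)
      (𝓝 (g (ξ + A) + C * 4 * n ^ 3 * κ * ‖A‖)) := by
    have : Continuous fun δ : ℝ => g (ξ + A) + C * 4 * n ^ 3 * κ * ‖A‖ + B * δ := by fun_prop
    simpa using (this.tendsto 0).mono_left nhdsWithin_le_nhds
  refine ge_of_tendsto hlim ?_
  filter_upwards [Ioo_mem_nhdsGT one_pos] with δ hδ
  exact key ⟨δ, hδ.1.le⟩ hδ.1 hδ.2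

lemma IsHomogenized.abs_sub_le {N n : ℕ} (hn : 1 ≤ n) {C α : ℝ} (hC : 1 ≤ C)
    {f : Vec n → Mat N n → ℝ} (hf : Admissible C α f) {g : Mat N n → ℝ} (hg : IsHomogenized f g)
    (ξ₁ ξ₂ : Mat N n) :
    |g ξ₁ - g ξ₂| ≤ C * 4 * n ^ 3 * lipschitzExtensionConstant (Vec N) * ‖ξ₁ - ξ₂‖ := by
  have h1 := hg.le_add_mul_norm hn hC hf ξ₁ (ξ₂ - ξ₁)
  have h2 := hg.le_add_mul_norm hn hC hf ξ₂ (ξ₁ - ξ₂)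
  rw [add_sub_cancel] at h1 h2
  rw [norm_sub_rev] at h1
  exact abs_sub_le_iff.2 ⟨by linarith, by linarith⟩

/-! ### Covering by cubes on which a Lipschitz map is almost affine -/

lemma locallyIntegrable_of_bounded {X : Type*} [TopologicalSpace X] [MeasurableSpace X]
    {μ : Measure X} [IsLocallyFiniteMeasure μ] {G : X → ℝ} (hG : Measurable G) {M : ℝ}
    (hM : ∀ x, |G x| ≤ M) : LocallyIntegrable G μ :=
  (locallyIntegrable_const M).mono hG.aestronglyMeasurable
    (ae_of_all _ fun x => (hM x).trans (le_abs_self M))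

/-- The Vitali covering theorem for cubes, at points where `φ` is differentiable and which are
Lebesgue points of `G`. Cubes are sup-norm balls, so the covering is done in `Fin n → ℝ`. -/
lemma exists_finite_cubes {N n : ℕ} {φ : Vec n → Vec N} {L : NNReal} (hφ : LipschitzWith L φ)
    {G : Vec n → ℝ} (hG : Measurable G) {M : ℝ} (hM : ∀ x, |G x| ≤ M) {Q : Set (Vec n)}
    (hQo : IsOpen Q) (hQ : volume Q ≠ ⊤) {ε : ℝ} (hε : 0 < ε) :
    ∃ (ι : Type) (t : Finset ι) (c : ι → Vec n) (s : ι → ℝ), (∀ i ∈ t, 0 < s i) ∧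
      (∀ i ∈ t, cube (c i) (s i) ⊆ Q) ∧
      (t : Set ι).PairwiseDisjoint (fun i => cube (c i) (s i)) ∧
      (∀ i ∈ t, ∀ y ∈ cube (c i) (s i),
        ‖φ y - (φ (c i) + fderiv ℝ φ (c i) (y - c i))‖ ≤ ε * s i) ∧
      (∀ i ∈ t, s i ^ n * G (c i) ≤ (∫ y in cube (c i) (s i), G y) + ε * s i ^ n) ∧
      volume.real Q - ∑ i ∈ t, s i ^ n ≤ ε := by
  set T : (Fin n → ℝ) → Vec n := WithLp.toLp 2
  have hTm : MeasurePreserving T := PiLp.volume_preserving_toLp (Fin n)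
  have hTe : MeasurableEmbedding T := (MeasurableEquiv.toLp 2 (Fin n → ℝ)).measurableEmbedding
  set A : (Fin n → ℝ) →L[ℝ] Vec n :=
    (PiLp.continuousLinearEquiv 2 ℝ fun _ : Fin n => ℝ).symm.toContinuousLinearMap
  have hcube : ∀ (c : Fin n → ℝ) {r : ℝ}, 0 < r → T ⁻¹' cube (T c) (2 * r) = Metric.ball c r := by
    intro c r hr
    rw [cube_eq_preimage_ball _ (by positivity), mul_div_cancel_left₀ r two_ne_zero]
    rfl
  have hvol : ∀ (c : Fin n → ℝ) {r : ℝ}, 0 < r →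
      volume (Metric.closedBall c r) = ENNReal.ofReal ((2 * r) ^ n) := by
    intro c r hr
    rw [Real.volume_pi_closedBall _ hr.le, Fintype.card_fin]
  have hint : ∀ (c : Fin n → ℝ) {r : ℝ}, 0 < r →
      ∫ y in Metric.closedBall c r, G (T y) = ∫ y in cube (T c) (2 * r), G y := by
    intro c r hr
    rw [← hTm.setIntegral_preimage_emb hTe G, hcube c hr]
    refine setIntegral_congr_set (ae_eq_of_subset_of_measure_ge Metric.ball_subset_closedBall ?_
      Metric.isOpen_ball.measurableSet.nullMeasurableSet measure_closedBall_lt_top.ne).symm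
    rw [Real.volume_pi_ball _ hr, Real.volume_pi_closedBall _ hr.le]
  set V := Besicovitch.vitaliFamily (volume : Measure (Fin n → ℝ))
  set Q' : Set (Fin n → ℝ) := T ⁻¹' Q with hQ'
  have hQ'o : IsOpen Q' := hQo.preimage A.continuous
  -- the good points, and the good cubes centred at a good point
  set S : Set (Fin n → ℝ) := {x | x ∈ Q' ∧ DifferentiableAt ℝ φ (T x) ∧
    Tendsto (fun a => ⨍ y in a, G (T y)) (V.filterAt x) (𝓝 (G (T x)))}
  set F : (Fin n → ℝ) → Set (Set (Fin n → ℝ)) := fun x => {a | ∃ r, 0 < r ∧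
    a = Metric.closedBall x r ∧ a ⊆ Q' ∧
    (∀ y ∈ a, ‖φ (T y) - (φ (T x) + fderiv ℝ φ (T x) (T y - T x))‖ ≤ ε * (2 * r)) ∧
    (2 * r) ^ n * G (T x) ≤ (∫ y in a, G (T y)) + ε * (2 * r) ^ n}
  have hSQ : S =ᵐ[volume] Q' := by
    have h1 : ∀ᵐ x, DifferentiableAt ℝ φ (T x) :=
      hTm.quasiMeasurePreserving.ae hφ.ae_differentiableAt
    have h2 := V.ae_tendsto_average (f := fun y => G (T y))
      (locallyIntegrable_of_bounded (hG.comp hTm.measurable) fun x => hM (T x))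
    filter_upwards [h1, h2] with x hx1 hx2
    exact propext ⟨fun h => h.1, fun h => ⟨h, hx1, hx2⟩⟩
  have hfine : V.FineSubfamilyOn F S := by
    refine V.fineSubfamilyOn_of_frequently F S fun x hx => ?_
    obtain ⟨hxQ, hxd, hxG⟩ := hx
    have hd : ∀ᶠ y in 𝓝 x,
        ‖φ (T y) - (φ (T x) + fderiv ℝ φ (T x) (T y - T x))‖ ≤ ε * ‖y - x‖ := by
      have h1 : HasFDerivAt (fun y => φ (A y)) ((fderiv ℝ φ (T x)).comp A) x :=
        HasFDerivAt.comp x (by exact hxd.hasFDerivAt) A.hasFDerivAt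
      filter_upwards [h1.isLittleO.def hε] with y hy
      rw [← sub_sub]
      exact hy
    have hav : ∀ᶠ a in V.filterAt x, G (T x) < (⨍ y in a, G (T y)) + ε := by
      filter_upwards [hxG.eventually (lt_mem_nhds (sub_lt_self _ hε))] with a ha
      linarith
    refine Eventually.frequently ?_
    filter_upwards [V.eventually_filterAt_mem_setsAt x, hav,
      V.eventually_filterAt_subset_of_nhds (hQ'o.mem_nhds hxQ),
      V.eventually_filterAt_subset_of_nhds hd] with a ha hag haQ had
    obtain ⟨r, hr, rfl⟩ := ha
    have hr : 0 < r := hr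
    refine ⟨r, hr, rfl, haQ, fun y hy => ?_, ?_⟩
    · refine (had hy).trans ?_
      have : ‖y - x‖ ≤ r := by rw [← dist_eq_norm]; exact hy
      gcongr
      linarith
    · have hpos : (0 : ℝ) < (2 * r) ^ n := by positivity
      rw [setAverage_eq, Measure.real, hvol x hr, ENNReal.toReal_ofReal hpos.le, smul_eq_mul] at hag
      calc (2 * r) ^ n * G (T x)
          ≤ (2 * r) ^ n * (((2 * r) ^ n)⁻¹ * (∫ y in Metric.closedBall x r, G (T y)) + ε) := by
            gcongr
        _ = _ := by field_simp
  have hmem : ∀ p : hfine.index, hfine.covering p ∈ F p.1.1 := fun p => hfine.covering_mem p.2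
  choose r hr0 hrball hrQ hrd hrG using hmem
  have hcb : ∀ p : hfine.index, T ⁻¹' cube (T p.1.1) (2 * r p) ⊆ hfine.covering p := by
    intro p
    rw [hcube _ (hr0 p), hrball p]
    exact Metric.ball_subset_closedBall
  -- finitely many of the cubes already exhaust `Q` up to measure `ε`
  obtain ⟨u, hu⟩ : ∃ u : Finset hfine.index,
      volume S ≤ ∑ p ∈ u, volume (hfine.covering p) + ENNReal.ofReal ε := by
    by_contra! hcon
    have hfin : volume S ≠ ⊤ := by
      rw [measure_congr hSQ, hQ', hTm.measure_preimage hQo.measurableSet.nullMeasurableSet]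
      exact hQ
    have h1 : volume S ≤ volume S - ENNReal.ofReal ε := by
      refine hfine.measure_le_tsum.trans ?_
      rw [ENNReal.tsum_eq_iSup_sum]
      exact iSup_le fun u => ENNReal.le_sub_of_add_le_right ENNReal.ofReal_ne_top (hcon u).le
    have h2 : volume S ≠ 0 := fun h => by simpa [h] using hcon ∅
    exact absurd h1 (not_le.2 (ENNReal.sub_lt_self hfin h2 (by simpa using hε)))
  refine ⟨hfine.index, u, fun p => T p.1.1, fun p => 2 * r p, fun p _ => by have := hr0 p; positivity,
    fun p _ y hy => ?_, fun p _ q _ hpq => ?_, fun p _ y hy => ?_, fun p _ => ?_, ?_⟩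
  · exact hrQ p (hcb p (show T (WithLp.ofLp y) ∈ _ from hy))
  · refine Set.disjoint_left.2 fun y hy hy' => ?_
    exact Set.disjoint_left.1 (hfine.covering_disjoint_subtype hpq)
      (hcb p (show T (WithLp.ofLp y) ∈ _ from hy)) (hcb q (show T (WithLp.ofLp y) ∈ _ from hy'))
  · exact hrd p _ (hcb p (show T (WithLp.ofLp y) ∈ _ from hy))
  · have := hrG p
    rwa [hrball p, hint _ (hr0 p)] at this
  · have h1 : volume S = volume Q := by
      rw [measure_congr hSQ, hQ', hTm.measure_preimage hQo.measurableSet.nullMeasurableSet]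
    have h2 : ∑ p ∈ u, volume (hfine.covering p) = ENNReal.ofReal (∑ p ∈ u, (2 * r p) ^ n) := by
      rw [ENNReal.ofReal_sum_of_nonneg fun p _ => by have := hr0 p; positivity]
      exact Finset.sum_congr rfl fun p _ => by rw [hrball p, hvol _ (hr0 p)]
    have h3 : (0 : ℝ) ≤ ∑ p ∈ u, (2 * r p) ^ n :=
      Finset.sum_nonneg fun p _ => by have := hr0 p; positivity
    rw [h1, h2, ← ENNReal.ofReal_add h3 hε.le] at hu
    have := ENNReal.toReal_le_of_le_ofReal (by positivity) hu
    rw [Measure.real]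
    linarith

/-! ### Quasiconvexity -/

lemma IsHomogenized.continuous {N n : ℕ} (hn : 1 ≤ n) {C α : ℝ} (hC : 1 ≤ C)
    {f : Vec n → Mat N n → ℝ} (hf : Admissible C α f) {g : Mat N n → ℝ} (hg : IsHomogenized f g) :
    Continuous g := by
  refine (LipschitzWith.of_dist_le_mul
    (K := ⟨C * 4 * n ^ 3 * lipschitzExtensionConstant (Vec N), by positivity⟩)
    fun ξ₁ ξ₂ => ?_).continuous
  rw [Real.dist_eq, dist_eq_norm]
  exact hg.abs_sub_le hn hC hf ξ₁ ξ₂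

/-- Quasiconvexity on a cube containing the support of the perturbation. -/
lemma IsHomogenized.mul_le_setIntegral_cube {N n : ℕ} (hn : 1 ≤ n) {C α : ℝ} (hC : 1 ≤ C)
    {f : Vec n → Mat N n → ℝ} (hf : Admissible C α f) {g : Mat N n → ℝ} (hg : IsHomogenized f g)
    {R : ℝ} (hR : 0 < R) (ξ : Mat N n) {φ : Vec n → Vec N} {L : NNReal} (hφ : LipschitzWith L φ)
    (h0 : ∀ y ∉ cube (0 : Vec n) R, φ y = 0) :
    R ^ n * g ξ ≤ ∫ y in cube (0 : Vec n) R, g (ξ + jacobian φ y) := by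
  set κ := lipschitzExtensionConstant (Vec N)
  set G : Vec n → ℝ := fun y => g (ξ + jacobian φ y)
  set I := ∫ y in cube (0 : Vec n) R, G y
  have hQ := volume_cube_ne_top (0 : Vec n) hR
  have hGm : Measurable G :=
    (hg.continuous hn hC hf).measurable.comp ((measurable_jacobian φ).const_add ξ)
  have hG0 : ∀ y, 0 ≤ G y := fun y => hg.nonneg hn hC hf _
  have hGM : ∀ y, |G y| ≤ C * (‖ξ‖ + n * L + 1) := by
    intro y
    rw [abs_of_nonneg (hG0 y)]
    refine (hg.le_mul hn hf _).trans ?_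
    gcongr
    exact (norm_add_le _ _).trans (by gcongr; exact norm_jacobian_le hφ y)
  have hGi : IntegrableOn G (cube (0 : Vec n) R) :=
    (integrableOn_const hQ).mono' (g := fun _ => C * (‖ξ‖ + n * L + 1))
      hGm.aestronglyMeasurable (ae_of_all _ hGM)
  -- an energy bound in the transition layers that does not depend on their width `δ`
  set B : ℝ := C * (‖ξ‖ + n * (κ * (L + n * L + 4)) + 1) with hB
  have hB0 : 0 ≤ B := by positivity
  have key : ∀ δ : NNReal, 0 < δ → δ < 1 →
      R ^ n * g ξ ≤ I + (R ^ n + B * (1 + n * R ^ n)) * δ := by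
    intro δ hδ hδ1
    have hδ' : (0 : ℝ) < δ := hδ
    have hδ1' : (δ : ℝ) < 1 := hδ1
    obtain ⟨ι, t, c, s, hs, hsub, hd, hclose, hleb, hcov⟩ :=
      exists_finite_cubes hφ hGm hGM (isOpen_cube 0 R) hQ hδ'
    rw [volumeReal_cube _ hR] at hcov
    obtain ⟨v, hv, hv0, hva⟩ := exists_lipschitz_affine hφ (Q := cube (0 : Vec n) R) t c s
      (fun i => φ (c i) - linMap (jacobian φ (c i)) (c i)) (fun i => jacobian φ (c i))
      (Λ := n * L) (ε := δ) hδ hs hsub hd (fun i _ => by simpa using norm_jacobian_le hφ (c i))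
      (fun i hi y hy => by
        refine le_trans (le_of_eq ?_) (hclose i hi y (cube_subset_cube _ ?_ hy))
        · rw [linMap_jacobian, linMap_jacobian, map_sub]
          congr 1
          abel
        · nlinarith [hs i hi])
    have hsm : ∀ i ∈ t, cube (c i) ((1 - δ) * s i) ⊆ cube (c i) (s i) := fun i hi =>
      cube_subset_cube _ (by nlinarith [hs i hi])
    have h1 := hg.mul_le_sum hn hC hf hR ξ hv (fun y hy => (hv0 y hy).trans (h0 y hy)) t c
      (fun i => (1 - δ) * s i) (fun i => jacobian φ (c i))
      (fun i hi => mul_pos (by linarith) (hs i hi))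
      (fun i hi => (hsm i hi).trans (hsub i hi))
      (fun i hi k hk hik => (hd hi hk hik).mono (hsm i hi) (hsm k hk))
      (fun i hi y hy z hz => by
        rw [hva i hi y hy, hva i hi z hz, ← linMapCLM_apply, ← linMapCLM_apply,
          ← linMapCLM_apply, ← linMapCLM_apply, map_sub]
        abel)
    have hconst : C * (‖ξ‖ + n * ((κ * (L + n * L + 4 * δ / δ) : NNReal) : ℝ) + 1) = B := by
      rw [hB]
      push_cast
      rw [mul_div_assoc, div_self hδ'.ne', mul_one]
    rw [hconst] at h1
    simp only [mul_pow, ← Finset.mul_sum, mul_assoc] at h1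
    set σ := ∑ i ∈ t, s i ^ n
    set q : ℝ := (1 - δ) ^ n
    have hq1 : q ≤ 1 := pow_le_one₀ (by linarith) (by linarith)
    have hqn : 1 - q ≤ n * δ := one_sub_pow_le hδ1'.le n
    have hdisj : ∑ i ∈ t, ∫ y in cube (c i) (s i), G y ≤ I := by
      rw [← integral_biUnion_finset t (fun i _ => measurableSet_cube _ _) hd
        fun i hi => hGi.mono_set (hsub i hi)]
      exact setIntegral_mono_set hGi (ae_of_all _ hG0)
        (LE.le.eventuallyLE (Set.iUnion₂_subset hsub))
    have hσR : σ ≤ R ^ n := by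
      have h2 := measureReal_mono (μ := volume) (Set.iUnion₂_subset hsub) hQ
      rw [measureReal_biUnion_finset hd (fun i _ => measurableSet_cube _ _)
        fun i hi => volume_cube_ne_top (c i) (hs i hi), volumeReal_cube _ hR] at h2
      refine le_trans (le_of_eq ?_) h2
      exact Finset.sum_congr rfl fun i hi => (volumeReal_cube (c i) (hs i hi)).symm
    have hsum0 : 0 ≤ ∑ i ∈ t, s i ^ n * G (c i) := Finset.sum_nonneg fun i hi =>
      mul_nonneg (pow_nonneg (hs i hi).le n) (hG0 _)
    have hsum : ∑ i ∈ t, s i ^ n * G (c i) ≤ I + δ * R ^ n := by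
      calc ∑ i ∈ t, s i ^ n * G (c i)
          ≤ ∑ i ∈ t, ((∫ y in cube (c i) (s i), G y) + δ * s i ^ n) := Finset.sum_le_sum hleb
        _ = ∑ i ∈ t, (∫ y in cube (c i) (s i), G y) + δ * σ := by
            rw [Finset.sum_add_distrib, Finset.mul_sum]
        _ ≤ I + δ * R ^ n := by gcongr
    have h2 : q * ∑ i ∈ t, s i ^ n * G (c i) ≤ I + δ * R ^ n :=
      (mul_le_of_le_one_left hsum0 hq1).trans hsum
    have h3 : R ^ n - q * σ ≤ (1 + n * R ^ n) * δ := by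
      have : (1 - q) * σ ≤ n * δ * R ^ n :=
        mul_le_mul hqn hσR (Finset.sum_nonneg fun i hi => pow_nonneg (hs i hi).le n)
          (by positivity)
      linarith
    have h4 := mul_le_mul_of_nonneg_left h3 hB0
    have h5 := h1.trans (add_le_add h2 h4)
    linarith
  have hlim : Tendsto (fun δ : ℝ => I + (R ^ n + B * (1 + n * R ^ n)) * δ) (𝓝[>] 0) (𝓝 I) := by
    have : Continuous fun δ : ℝ => I + (R ^ n + B * (1 + n * R ^ n)) * δ := by fun_prop
    simpa using (this.tendsto 0).mono_left nhdsWithin_le_nhds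
  refine ge_of_tendsto hlim ?_
  filter_upwards [Ioo_mem_nhdsGT one_pos] with δ hδ
  exact key ⟨δ, hδ.1.le⟩ hδ.1 hδ.2

lemma exists_subset_cube_zero {n : ℕ} {D : Set (Vec n)} (hD : Bornology.IsBounded D) :
    ∃ R, 0 < R ∧ D ⊆ cube (0 : Vec n) R := by
  obtain ⟨M, hM⟩ := hD.exists_norm_le
  refine ⟨2 * (|M| + 1), by positivity, fun y hy i => ?_⟩
  have h1 : |y i| ≤ ‖y‖ := PiLp.norm_apply_le y i
  have h2 := (hM y hy).trans (le_abs_self M)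
  simp only [PiLp.zero_apply, sub_zero]
  linarith

theorem IsHomogenized.quasiconvex {N n : ℕ} (hn : 1 ≤ n) {C α : ℝ} (hC : 1 ≤ C)
    {f : Vec n → Mat N n → ℝ} (hf : Admissible C α f) {g : Mat N n → ℝ} (hg : IsHomogenized f g) :
    Quasiconvex g := by
  refine ⟨(hg.continuous hn hC hf).measurable, fun R => ⟨C * (R + 1), fun ξ hξ => ?_⟩, ?_⟩
  · rw [abs_of_nonneg (hg.nonneg hn hC hf ξ)]
    exact (hg.le_mul hn hf ξ).trans (by gcongr)
  rintro D hDo hDb ξ φ ⟨L, hφ⟩ h0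
  obtain ⟨R, hR, hDR⟩ := exists_subset_cube_zero hDb
  set Q := cube (0 : Vec n) R with hQdef
  have hQ : volume Q ≠ ⊤ := volume_cube_ne_top _ hR
  have hGi : IntegrableOn (fun y => g (ξ + jacobian φ y)) Q := by
    refine (integrableOn_const hQ).mono' (g := fun _ => C * (‖ξ‖ + n * L + 1))
      ((hg.continuous hn hC hf).measurable.comp
        ((measurable_jacobian φ).const_add ξ)).aestronglyMeasurable (ae_of_all _ fun y => ?_)
    rw [Real.norm_of_nonneg (hg.nonneg hn hC hf _)]
    refine (hg.le_mul hn hf _).trans ?_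
    gcongr
    exact (norm_add_le _ _).trans (by gcongr; exact norm_jacobian_le hφ y)
  have h1 := hg.mul_le_setIntegral_cube hn hC hf hR ξ hφ fun y hy => h0 y fun h => hy (hDR h)
  -- on `Q \ D` the gradient vanishes, even where `∂D` has positive measure
  have h2 : ∫ y in Q \ D, g (ξ + jacobian φ y) = (R ^ n - volume.real D) * g ξ := by
    have hm : MeasurableSet (Q \ D) := (measurableSet_cube _ _).diff hDo.measurableSet
    rw [setIntegral_congr_ae (g := fun _ => g ξ) hm (by
      filter_upwards [ae_jacobian_eq_zero_of_eq_zero hn hφ] with y hy hyD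
      rw [hy (h0 y hyD.2), add_zero]), setIntegral_const, smul_eq_mul,
      measureReal_sdiff hDR hDo.measurableSet hQ, volumeReal_cube _ hR]
  have h3 : ∫ y in Q, g (ξ + jacobian φ y) =
      (∫ y in D, g (ξ + jacobian φ y)) + ∫ y in Q \ D, g (ξ + jacobian φ y) := by
    rw [← setIntegral_union Set.disjoint_sdiff_right
      ((measurableSet_cube _ _).diff hDo.measurableSet) (hGi.mono_set hDR)
      (hGi.mono_set Set.sdiff_subset), Set.union_sdiff_cancel hDR]
  rw [← hQdef, h3, h2] at h1
  linarith

end Homog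

theorem proposition4p1 (n N : ℕ) (hn : 2 ≤ n) (C : ℝ) (hC : 1 ≤ C) :
    ∃ K : ℝ, ∀ (α : ℝ), 0 < α → α < 1 →
      ∀ f : Homog.Vec n → Homog.Mat N n → ℝ, Homog.Admissible C α f →
      ∀ fhom : Homog.Mat N n → ℝ,
        (∀ (x : Homog.Vec n) (ξ : Homog.Mat N n),
          Tendsto (fun r : ℝ => Homog.minEnergy f (Homog.linMap ξ) (r • x) r / r ^ n)
            atTop (𝓝 (fhom ξ))) →
        Homog.Quasiconvex fhom ∧
        (∀ ξ₁ ξ₂ : Homog.Mat N n, |fhom ξ₁ - fhom ξ₂| ≤ K * ‖ξ₁ - ξ₂‖) ∧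
        (∀ ξ : Homog.Mat N n, C⁻¹ * ‖ξ‖ ≤ fhom ξ ∧ fhom ξ ≤ C * (‖ξ‖ + 1)) := by
  have hn1 : 1 ≤ n := by omega
  refine ⟨C * 4 * n ^ 3 * lipschitzExtensionConstant (Homog.Vec N),
    fun α _ _ f hf fhom hlim => ?_⟩
  have hg : Homog.IsHomogenized f fhom := hlim
  exact ⟨hg.quasiconvex hn1 hC hf, hg.abs_sub_le hn1 hC hf,
    fun ξ => ⟨hg.mul_le hn1 hC hf ξ, hg.le_mul hn1 hf ξ⟩⟩
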